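/- Let $G$ be a discrete group and let $\mathcal B=\{B_t\}_{t\in G}$ be a Fell bundle over $G$, with unit fiber $B_e$ and reduced cross-sectional $C^*$-algebra $C^*_r(\mathcal B)$, i.e. the completion of the $*$-algebra $\bigoplus_{t\in G}B_t$ of finitely supported sections in the operator norm of its regular representation on the Hilbert $B_e$-module $\ell^2(\mathcal B)$. For $t\in G$ let $F_t:C^*_r(\mathcal B)\to B_t\subseteq C^*_r(\mathcal B)$ be the Fourier coefficient operator, i.e. the continuous extension of the projection $\bigoplus_{s\in G}B_s\to B_t$. An ideal in $\mathcal B$ is a family $\mathcal J=\{J_t\}_{t\in G}$ of closed subspaces $J_t\subseteq B_t$ with $B_sJ_t\subseteq J_{st}$ and $J_sB_t\subseteq J_{st}$ for all $s,t\in G$; then $\mathcal J$ and $\mathcal B/\mathcal J=\{B_t/J_t\}_{t\in G}$ are Fell bundles, and the inclusion and the quotient map induce homomorphisms $\iota_r:C^*_r(\mathcal J)\to C^*_r(\mathcal B)$ and $\kappa_r:C^*_r(\mathcal B)\to C^*_r(\mathcal B/\mathcal J)$. The Fell bundle $\mathcal B$ is called exact if the sequence $$0\longrightarrow C^*_r(\mathcal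 J)\stackrel{\iota_r}{\longrightarrow}C^*_r(\mathcal B)\stackrel{\kappa_r}{\longrightarrow}C^*_r(\mathcal B/\mathcal J)\longrightarrow 0$$ is exact for every ideal $\mathcal J$ in $\mathcal B$. A closed two-sided ideal $J$ in $C^*_r(\mathcal B)$ is called Fourier if $F_t(J)\subseteq J$ for all $t\in G$, and graded if $J=\overline{\bigoplus_{t\in G}J\cap B_t}$. Then $\mathcal B$ is exact if and only if every Fourier ideal in $C^*_r(\mathcal B)$ is graded. -/

import Mathlib

open scoped DirectSum

universe u v

noncomputable section


namespace CStarAux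

theorem exists_resolvent {U : Type*} [CStarAlgebra U] [PartialOrder U] [StarOrderedRing U]
    (K : U) (hK0 : 0 ≤ K) {ε : ℝ} (hε : 0 < ε) :
    ∃ W C : U, K * W = 1 - C ∧ IsSelfAdjoint C ∧ ‖C‖ ≤ 1 ∧ ‖K * W‖ ≤ 1 ∧
      ‖C * K * C‖ ≤ ε := by
  have hKs : IsSelfAdjoint K := hK0.isSelfAdjoint
  have hspec0 : ∀ z ∈ spectrum ℝ K, 0 ≤ z := fun z hz => spectrum_nonneg_of_nonneg hK0 hz
  have hspec : ∀ z ∈ spectrum ℝ K, 0 < z + ε := fun z hz => by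
    have := hspec0 z hz
    positivity
  have hc : ContinuousOn (fun z : ℝ => (z + ε)⁻¹) (spectrum ℝ K) :=
    ContinuousOn.inv₀ (by fun_prop) fun z hz => (hspec z hz).ne'
  have hc1 : ContinuousOn (fun z : ℝ => z * (z + ε)⁻¹) (spectrum ℝ K) :=
    continuousOn_id.mul hc
  have hc2 : ContinuousOn (fun z : ℝ => ε * (z + ε)⁻¹) (spectrum ℝ K) :=
    continuousOn_const.mul hc
  have hc3 : ContinuousOn (fun z : ℝ => ε * (z + ε)⁻¹ * z) (spectrum ℝ K) :=
    hc2.mul continuousOn_id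
  have hKW : K * cfc (fun z : ℝ => (z + ε)⁻¹) K = cfc (fun z : ℝ => z * (z + ε)⁻¹) K := by
    rw [cfc_mul (fun z : ℝ => z) (fun z : ℝ => (z + ε)⁻¹) K continuousOn_id hc,
      cfc_id' ℝ K hKs]
  refine ⟨cfc (fun z : ℝ => (z + ε)⁻¹) K, cfc (fun z : ℝ => ε * (z + ε)⁻¹) K, ?_,
    cfc_predicate _ _, ?_, ?_, ?_⟩
  · rw [hKW, ← cfc_const_one ℝ K hKs,
      ← cfc_sub (fun _ : ℝ => (1 : ℝ)) (fun z : ℝ => ε * (z + ε)⁻¹) K continuousOn_const hc2]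
    refine cfc_congr fun z hz => ?_
    have := (hspec z hz).ne'
    field_simp
    ring
  · refine norm_cfc_le zero_le_one fun z hz => ?_
    have h0 := hspec0 z hz
    rw [Real.norm_of_nonneg (by positivity), ← div_eq_mul_inv, div_le_one (hspec z hz)]
    linarith
  · rw [hKW]
    refine norm_cfc_le zero_le_one fun z hz => ?_
    have h0 := hspec0 z hz
    rw [Real.norm_of_nonneg (by positivity), ← div_eq_mul_inv, div_le_one (hspec z hz)]
    linarith
  · have : cfc (fun z : ℝ => ε * (z + ε)⁻¹) K * K * cfc (fun z : ℝ => ε * (z + ε)⁻¹) K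
        = cfc (fun z : ℝ => ε * (z + ε)⁻¹ * z * (ε * (z + ε)⁻¹)) K := by
      rw [cfc_mul (fun z : ℝ => ε * (z + ε)⁻¹ * z) (fun z : ℝ => ε * (z + ε)⁻¹) K hc3 hc2,
        cfc_mul (fun z : ℝ => ε * (z + ε)⁻¹) (fun z : ℝ => z) K hc2 continuousOn_id,
        cfc_id' ℝ K hKs]
    rw [this]
    refine norm_cfc_le hε.le fun z hz => ?_
    have h0 := hspec0 z hz
    have h1 := hspec z hz
    rw [Real.norm_of_nonneg (by positivity)]
    have e : ε * (z + ε)⁻¹ * z * (ε * (z + ε)⁻¹) = ε * ((ε * z) / (z + ε) ^ 2) := by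
      field_simp
    rw [e]
    refine mul_le_of_le_one_right hε.le ((div_le_one (by positivity)).2 ?_)
    nlinarith [mul_nonneg h0 hε.le, sq_nonneg z, sq_nonneg ε]

/-- An element `u = j⋆j v + μ j⋆j` which almost fixes `j`. -/
theorem exists_approx {A : Type*} [NonUnitalCStarAlgebra A] (j : A) {ε : ℝ} (hε : 0 < ε) :
    ∃ (v : A) (μ : ℂ) (u : A), u = star j * j * v + μ • (star j * j) ∧ star u = u ∧ ‖u‖ ≤ 1 ∧
      ∀ y : A, ‖y - y * u - u * y + u * y * u‖ ≤ ‖y + j‖ + ε := by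
  let _ : PartialOrder (Unitization ℂ A) := CStarAlgebra.spectralOrder _
  have _ : StarOrderedRing (Unitization ℂ A) := CStarAlgebra.spectralOrderedRing _
  obtain ⟨W, C, hsum, hCs, hC1, hU1, hCKC⟩ := exists_resolvent
    (star (j : Unitization ℂ A) * (j : Unitization ℂ A)) (star_mul_self_nonneg _)
    (by positivity : 0 < ε ^ 2)
  have hJC : ‖(j : Unitization ℂ A) * C‖ ≤ ε := by
    have : ‖(j : Unitization ℂ A) * C‖ ^ 2 ≤ ε ^ 2 := by
      rw [pow_two ‖_‖, ← CStarRing.norm_star_mul_self, star_mul, hCs.star_eq, mul_assoc,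
        ← mul_assoc (star _), ← mul_assoc]
      exact hCKC
    exact (pow_le_pow_iff_left₀ (norm_nonneg _) hε.le two_ne_zero).1 this
  refine ⟨W.snd, W.fst, star j * j * W.snd + W.fst • (star j * j), rfl, ?_⟩
  have hU : ((star j * j * W.snd + W.fst • (star j * j) : A) : Unitization ℂ A)
      = star (j : Unitization ℂ A) * (j : Unitization ℂ A) * W := by
    rw [← Unitization.inr_star, ← Unitization.inr_mul]
    generalize star j * j = k
    refine Unitization.ext ?_ ?_
    · rw [Unitization.fst_mul]; simp
    · rw [Unitization.snd_mul]; simp [add_comm]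
  generalize star j * j * W.snd + W.fst • (star j * j) = u at hU
  have hu : (u : Unitization ℂ A) = 1 - C := hU.trans hsum
  refine ⟨?_, ?_, fun y => ?_⟩
  · apply Unitization.inr_injective (R := ℂ)
    rw [Unitization.inr_star, hu, star_sub, star_one, hCs.star_eq]
  · rw [← Unitization.norm_inr (𝕜 := ℂ), hU]; exact hU1
  · rw [← Unitization.norm_inr (𝕜 := ℂ)]
    have e : ((y - y * u - u * y + u * y * u : A) : Unitization ℂ A)
        = C * ((y + j : A) : Unitization ℂ A) * C - C * ((j : Unitization ℂ A) * C) := by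
      simp only [Unitization.inr_add, Unitization.inr_sub, Unitization.inr_mul, hu]
      noncomm_ring
    rw [e]
    refine (norm_sub_le _ _).trans (add_le_add ?_ ?_)
    · calc _ ≤ ‖C‖ * ‖((y + j : A) : Unitization ℂ A)‖ * ‖C‖ :=
            (norm_mul_le _ _).trans (by gcongr; exact norm_mul_le _ _)
        _ ≤ 1 * ‖((y + j : A) : Unitization ℂ A)‖ * 1 := by gcongr
        _ = ‖y + j‖ := by rw [Unitization.norm_inr]; ring
    · calc _ ≤ ‖C‖ * ‖(j : Unitization ℂ A) * C‖ := norm_mul_le _ _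
        _ ≤ 1 * ε := by gcongr
        _ = ε := one_mul _

/-- A square root of `‖a⋆a‖ - a⋆a` in the unitization, written out in components. -/
theorem exists_sqrt {A : Type*} [NonUnitalCStarAlgebra A] (a : A) :
    ∃ (l : ℂ) (d : A), star l * l = (‖star a * a‖ : ℂ) ∧
      star l • d + l • star d + star d * d = -(star a * a) := by
  let _ : PartialOrder (Unitization ℂ A) := CStarAlgebra.spectralOrder _
  have _ : StarOrderedRing (Unitization ℂ A) := CStarAlgebra.spectralOrderedRing _
  have hs : IsSelfAdjoint ((star a * a : A) : Unitization ℂ A) := by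
    rw [isSelfAdjoint_iff, ← Unitization.inr_star]; simp
  have h := hs.le_algebraMap_norm_self
  rw [← sub_nonneg, CStarAlgebra.nonneg_iff_eq_star_mul_self] at h
  obtain ⟨D, hD⟩ := h
  rw [Unitization.norm_inr, sub_eq_iff_eq_add] at hD
  have e : (algebraMap ℝ (Unitization ℂ A) ‖star a * a‖) = Unitization.inl (‖star a * a‖ : ℂ) := rfl
  rw [e] at hD
  generalize star a * a = k at hD
  refine ⟨D.fst, D.snd, ?_, ?_⟩
  · have := congrArg (fun x => x.fst) hD
    simpa using this.symm
  · have := congrArg (fun x => x.snd) hD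
    simp only [Unitization.snd_inl, Unitization.snd_add, Unitization.snd_mul, Unitization.snd_inr,
      Unitization.fst_star, Unitization.snd_star] at this
    rw [eq_neg_iff_add_eq_zero]
    exact this.symm

end CStarAux
set_option linter.unusedSectionVars false
open UniformSpace in
/-- The completion of a normed `*`-algebra whose norm satisfies the C⋆-identity. -/
def CStarCompletion (R : Type*) [NonUnitalNormedRing R] : Type _ := Completion R

namespace CStarCompletion

open UniformSpace

variable {R : Type*} [NonUnitalNormedRing R]

instance : NormedAddCommGroup (CStarCompletion R) :=
  inferInstanceAs (NormedAddCommGroup (Completion R))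

instance : CompleteSpace (CStarCompletion R) := inferInstanceAs (CompleteSpace (Completion R))

instance [NormedSpace ℂ R] : NormedSpace ℂ (CStarCompletion R) :=
  inferInstanceAs (NormedSpace ℂ (Completion R))

/-- The canonical map of `R` into its completion. -/
def coe (a : R) : CStarCompletion R := ((a : Completion R) : Completion R)

theorem norm_coe (a : R) : ‖coe a‖ = ‖a‖ := Completion.norm_coe a

theorem continuous_coe : Continuous (coe : R → CStarCompletion R) := Completion.continuous_coe R

theorem isDenseInducing_coe : IsDenseInducing (coe : R → CStarCompletion R) :=
  Completion.isDenseInducing_coe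

theorem coe_zero : coe (0 : R) = 0 := Completion.coe_zero

theorem coe_add (a b : R) : coe (a + b) = coe a + coe b := Completion.coe_add a b

theorem coe_smul [NormedSpace ℂ R] (c : ℂ) (a : R) : coe (c • a) = c • coe a :=
  Completion.coe_smul c a

/-- The product of the completion, the continuous extension of the product of `R`. -/
instance : Mul (CStarCompletion R) :=
  ⟨Function.curry <| (isDenseInducing_coe.prodMap isDenseInducing_coe).extend
    (coe ∘ Function.uncurry ((· * ·) : R → R → R))⟩

theorem coe_mul (a b : R) : coe (a * b) = coe a * coe b :=
  ((isDenseInducing_coe.prodMap isDenseInducing_coe).extend_eq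
    (continuous_coe.comp (@continuous_mul R _ _ _)) (a, b)).symm

instance : ContinuousMul (CStarCompletion R) where
  continuous_mul := by
    let m := (AddMonoidHom.mul : R →+ R →+ R).compr₂
      (AddMonoidHom.mk' (coe : R → CStarCompletion R) coe_add)
    have : Continuous fun p : R × R => m p.1 p.2 := continuous_coe.comp continuous_mul
    have di : IsDenseInducing
        (AddMonoidHom.mk' (coe : R → CStarCompletion R) coe_add) := isDenseInducing_coe
    exact (di.extend_Z_bilin di this :)

@[elab_as_elim]
theorem induction_on {p : CStarCompletion R → Prop} (x : CStarCompletion R)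
    (hp : IsClosed {x | p x}) (h : ∀ a : R, p (coe a)) : p x := Completion.induction_on x hp h

@[elab_as_elim]
theorem induction_on₂ {p : CStarCompletion R → CStarCompletion R → Prop} (x y : CStarCompletion R)
    (hp : IsClosed {x : CStarCompletion R × CStarCompletion R | p x.1 x.2})
    (h : ∀ a b : R, p (coe a) (coe b)) : p x y := Completion.induction_on₂ x y hp h

@[elab_as_elim]
theorem induction_on₃ {p : CStarCompletion R → CStarCompletion R → CStarCompletion R → Prop}
    (x y z : CStarCompletion R)
    (hp : IsClosed {x : CStarCompletion R × CStarCompletion R × CStarCompletion R |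
      p x.1 x.2.1 x.2.2})
    (h : ∀ a b c : R, p (coe a) (coe b) (coe c)) : p x y z := Completion.induction_on₃ x y z hp h

instance : NonUnitalNormedRing (CStarCompletion R) :=
  { (inferInstance : NormedAddCommGroup (CStarCompletion R)),
    (inferInstance : Mul (CStarCompletion R)) with
    zero_mul := fun a => induction_on a (isClosed_eq (by fun_prop) continuous_const)
      fun a => by rw [← coe_zero, ← coe_mul, zero_mul]
    mul_zero := fun a => induction_on a (isClosed_eq (by fun_prop) continuous_const)
      fun a => by rw [← coe_zero, ← coe_mul, mul_zero]
    mul_assoc := fun a b c => induction_on₃ a b c (isClosed_eq (by fun_prop) (by fun_prop))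
      fun a b c => by simp only [← coe_mul, mul_assoc]
    left_distrib := fun a b c => induction_on₃ a b c (isClosed_eq (by fun_prop) (by fun_prop))
      fun a b c => by simp only [← coe_mul, ← coe_add, mul_add]
    right_distrib := fun a b c => induction_on₃ a b c (isClosed_eq (by fun_prop) (by fun_prop))
      fun a b c => by simp only [← coe_mul, ← coe_add, add_mul]
    norm_mul_le := fun a b => induction_on₂ a b (isClosed_le (by fun_prop) (by fun_prop))
      fun a b => by simp only [← coe_mul, norm_coe]; exact norm_mul_le a b }

variable [StarRing R] [CStarRing R]

/-- The involution of the completion, the continuous extension of the involution of `R`. -/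
instance : Star (CStarCompletion R) := ⟨fun x => Completion.map (star : R → R) x⟩

theorem uniformContinuous_star : UniformContinuous (star : R → R) :=
  (show Isometry (star : R → R) from star_isometry).uniformContinuous

theorem coe_star (a : R) : coe (star a) = star (coe a) :=
  (Completion.map_coe uniformContinuous_star a).symm

instance : ContinuousStar (CStarCompletion R) := ⟨Completion.continuous_map⟩

instance : StarRing (CStarCompletion R) where
  star_involutive := fun a => induction_on a (isClosed_eq (by fun_prop) (by fun_prop))
    fun a => by rw [← coe_star, ← coe_star, star_star]
  star_mul := fun a b => induction_on₂ a b (isClosed_eq (by fun_prop) (by fun_prop))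
    fun a b => by simp only [← coe_star, ← coe_mul, star_mul]
  star_add := fun a b => induction_on₂ a b (isClosed_eq (by fun_prop) (by fun_prop))
    fun a b => by simp only [← coe_star, ← coe_add, star_add]

instance : CStarRing (CStarCompletion R) where
  norm_mul_self_le := fun a => induction_on a (isClosed_le (by fun_prop) (by fun_prop))
    fun a => by
      rw [← coe_star, ← coe_mul, norm_coe, norm_coe, CStarRing.norm_star_mul_self]

variable [NormedSpace ℂ R] [IsScalarTower ℂ R R] [SMulCommClass ℂ R R] [StarModule ℂ R]

instance : IsScalarTower ℂ (CStarCompletion R) (CStarCompletion R) where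
  smul_assoc := fun c a b => induction_on₂ a b
    (isClosed_eq ((continuous_fst.const_smul c).mul continuous_snd)
      ((continuous_fst.mul continuous_snd).const_smul c))
    fun a b => by simp only [smul_eq_mul, ← coe_smul, ← coe_mul, smul_mul_assoc]

instance : SMulCommClass ℂ (CStarCompletion R) (CStarCompletion R) where
  smul_comm := fun c a b => induction_on₂ a b
    (isClosed_eq ((continuous_fst.mul continuous_snd).const_smul c)
      (continuous_fst.mul (continuous_snd.const_smul c)))
    fun a b => by simp only [smul_eq_mul, ← coe_smul, ← coe_mul, mul_smul_comm]

instance : StarModule ℂ (CStarCompletion R) where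
  star_smul := fun c a => induction_on a
    (isClosed_eq (continuous_id.const_smul c).star (continuous_id.star.const_smul (star c)))
    fun a => by simp only [← coe_smul, ← coe_star, star_smul]

instance : NonUnitalCStarAlgebra (CStarCompletion R) where

/-- The canonical map of `R` into its completion, as a linear map. -/
def coeL : R →L[ℂ] CStarCompletion R := (Completion.toComplL : R →L[ℂ] Completion R)

variable {S : Type*} [NonUnitalNormedRing S] [StarRing S] [CStarRing S]
  [NormedSpace ℂ S] [IsScalarTower ℂ S S] [SMulCommClass ℂ S S] [StarModule ℂ S]

/-- The continuous extension of a map to the completions, as a bare function. -/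
def mapFun (φ : R → S) : CStarCompletion R → CStarCompletion S := Completion.map φ

theorem continuous_mapFun (φ : R → S) : Continuous (mapFun φ) := Completion.continuous_map

theorem mapFun_coe (φ : R →⋆ₙₐ[ℂ] S) (hφ : ∀ a, ‖φ a‖ ≤ ‖a‖) (a : R) :
    mapFun φ (coe a) = coe (φ a) :=
  Completion.map_coe
    ((φ : R →ₗ[ℂ] S).mkContinuous 1 (fun a => by simpa using hφ a)).uniformContinuous a

/-- The extension by continuity of a contractive `*`-homomorphism to the completions. -/
def map (φ : R →⋆ₙₐ[ℂ] S) (hφ : ∀ a, ‖φ a‖ ≤ ‖a‖) : CStarCompletion R →⋆ₙₐ[ℂ] CStarCompletion S :=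
  have hc := continuous_mapFun φ
  { toFun := mapFun φ
    map_zero' := by rw [← coe_zero, mapFun_coe φ hφ, map_zero, coe_zero]
    map_add' := fun a b => induction_on₂ a b (isClosed_eq (by fun_prop) (by fun_prop))
      fun a b => by simp only [← coe_add, mapFun_coe φ hφ, map_add]
    map_mul' := fun a b => induction_on₂ a b (isClosed_eq (by fun_prop) (by fun_prop))
      fun a b => by simp only [← coe_mul, mapFun_coe φ hφ, map_mul]
    map_smul' := fun c a => induction_on a
      (isClosed_eq (hc.comp (continuous_id.const_smul c)) (hc.const_smul c))
      fun a => by simp only [← coe_smul, mapFun_coe φ hφ, map_smul, MonoidHom.id_apply]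
    map_star' := fun a => induction_on a (isClosed_eq (by fun_prop) (by fun_prop))
      fun a => by simp only [← coe_star, mapFun_coe φ hφ, map_star] }

end CStarCompletion

/-- A Fell bundle over a discrete group `G`: a family of complex Banach spaces `fiber t` with
bilinear associative products `fiber s × fiber t → fiber (s * t)` and conjugate-linear
antimultiplicative involutions `fiber s → fiber s⁻¹`, satisfying `‖a b‖ ≤ ‖a‖ ‖b‖`,
`‖a⋆ a‖ = ‖a‖²` and `a⋆ a ≥ 0` in the C⋆-algebra `fiber 1` (that is, `a⋆ a = c⋆ c` with `c` in
`fiber 1`). The product takes a proof of `s * t = u` and has values in `fiber u`, similarly for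
the involution; this only serves to avoid casts between the fibers over equal group elements. -/
structure FellBundle (G : Type u) [Group G] where
  fiber : G → Type v
  [normedAddCommGroup : ∀ t, NormedAddCommGroup (fiber t)]
  [normedSpace : ∀ t, NormedSpace ℂ (fiber t)]
  [completeSpace : ∀ t, CompleteSpace (fiber t)]
  mul : ∀ {s t u : G}, s * t = u → fiber s → fiber t → fiber u
  inv : ∀ {s t : G}, s⁻¹ = t → fiber s → fiber t
  add_mul : ∀ {s t u : G} (h : s * t = u) (a b : fiber s) (c : fiber t),
    mul h (a + b) c = mul h a c + mul h b c
  mul_add : ∀ {s t u : G} (h : s * t = u) (a : fiber s) (b c : fiber t),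
    mul h a (b + c) = mul h a b + mul h a c
  smul_mul : ∀ {s t u : G} (h : s * t = u) (z : ℂ) (a : fiber s) (b : fiber t),
    mul h (z • a) b = z • mul h a b
  mul_smul : ∀ {s t u : G} (h : s * t = u) (z : ℂ) (a : fiber s) (b : fiber t),
    mul h a (z • b) = z • mul h a b
  mul_assoc : ∀ {r s t p q w : G} (h₁ : r * s = p) (h₂ : p * t = w) (h₃ : s * t = q)
    (h₄ : r * q = w) (a : fiber r) (b : fiber s) (c : fiber t),
    mul h₂ (mul h₁ a b) c = mul h₄ a (mul h₃ b c)
  inv_add : ∀ {s t : G} (h : s⁻¹ = t) (a b : fiber s), inv h (a + b) = inv h a + inv h b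
  inv_smul : ∀ {s t : G} (h : s⁻¹ = t) (z : ℂ) (a : fiber s), inv h (z • a) = star z • inv h a
  inv_inv : ∀ {s t : G} (h : s⁻¹ = t) (h' : t⁻¹ = s) (a : fiber s), inv h' (inv h a) = a
  inv_mul : ∀ {s t p s' t' p' : G} (h : s * t = p) (hs : s⁻¹ = s') (ht : t⁻¹ = t')
    (hp : p⁻¹ = p') (h' : t' * s' = p') (a : fiber s) (b : fiber t),
    inv hp (mul h a b) = mul h' (inv ht b) (inv hs a)
  norm_mul_le : ∀ {s t u : G} (h : s * t = u) (a : fiber s) (b : fiber t),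
    ‖mul h a b‖ ≤ ‖a‖ * ‖b‖
  norm_inv_mul_self : ∀ {s t : G} (h : s⁻¹ = t) (h' : t * s = 1) (a : fiber s),
    ‖mul h' (inv h a) a‖ = ‖a‖ * ‖a‖
  inv_mul_self_nonneg : ∀ {s t : G} (h : s⁻¹ = t) (h' : t * s = 1) (a : fiber s),
    ∃ c : fiber 1, mul h' (inv h a) a = mul (one_mul 1) (inv inv_one c) c

attribute [instance] FellBundle.normedAddCommGroup FellBundle.normedSpace
  FellBundle.completeSpace

namespace FellBundle

variable {G : Type u} [Group G] (B : FellBundle.{u, v} G)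

theorem norm_inv {s t : G} (h : s⁻¹ = t) (a : B.fiber s) : ‖B.inv h a‖ = ‖a‖ := by
  have key : ∀ {s t : G} (h : s⁻¹ = t) (a : B.fiber s), ‖a‖ ≤ ‖B.inv h a‖ := by
    intro s t h a
    have h' : t * s = 1 := by rw [← h, inv_mul_cancel]
    have h1 := B.norm_inv_mul_self h h' a
    have h2 := B.norm_mul_le h' (B.inv h a) a
    rw [h1] at h2
    rcases (norm_nonneg a).eq_or_lt with h0 | h0
    · rw [← h0]; exact norm_nonneg _
    · exact le_of_mul_le_mul_right h2 h0
  have h' : t⁻¹ = s := by rw [← h, _root_.inv_inv]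
  refine le_antisymm ?_ (key h a)
  simpa [B.inv_inv h h'] using key h' (B.inv h a)

/-- The unit fiber of a Fell bundle is a C⋆-algebra. -/
instance : Mul (B.fiber 1) := ⟨B.mul (one_mul 1)⟩

instance : Star (B.fiber 1) := ⟨B.inv inv_one⟩

theorem mul_def (a b : B.fiber 1) : a * b = B.mul (one_mul 1) a b := rfl

theorem star_def (a : B.fiber 1) : star a = B.inv inv_one a := rfl

instance : NonUnitalNormedRing (B.fiber 1) :=
  { B.normedAddCommGroup 1, (inferInstance : Mul (B.fiber 1)) with
    left_distrib := fun a b c => B.mul_add _ a b c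
    right_distrib := fun a b c => B.add_mul _ a b c
    zero_mul := fun a => by
      have := B.smul_mul (one_mul 1) 0 (0 : B.fiber 1) a
      rwa [zero_smul, zero_smul] at this
    mul_zero := fun a => by
      have := B.mul_smul (one_mul 1) 0 a (0 : B.fiber 1)
      rwa [zero_smul, zero_smul] at this
    mul_assoc := fun a b c => B.mul_assoc _ _ _ _ a b c
    norm_mul_le := fun a b => B.norm_mul_le _ a b }

instance : StarRing (B.fiber 1) where
  star_involutive := fun a => B.inv_inv _ _ a
  star_mul := fun a b => B.inv_mul _ _ _ _ _ a b
  star_add := fun a b => B.inv_add _ a b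

instance : NonUnitalCStarAlgebra (B.fiber 1) where
  norm_mul_self_le := fun a => (B.norm_inv_mul_self inv_one (one_mul 1) a).ge
  smul_assoc := fun z a b => B.smul_mul _ z a b
  smul_comm := fun z a b => (B.mul_smul _ z a b).symm
  star_smul := fun z a => B.inv_smul _ z a

/-- The order of the C⋆-algebra `fiber 1`: `a ≤ b` iff `b - a = c⋆ c` for some `c`. -/
instance : PartialOrder (B.fiber 1) := CStarAlgebra.spectralOrder _

instance : StarOrderedRing (B.fiber 1) := CStarAlgebra.spectralOrderedRing _

theorem inv_mul_self_nonneg' {s t : G} (h : s⁻¹ = t) (h' : t * s = 1) (a : B.fiber s) :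
    0 ≤ B.mul h' (B.inv h a) a := by
  obtain ⟨c, hc⟩ := B.inv_mul_self_nonneg h h' a
  rw [hc]
  exact star_mul_self_nonneg c

/-- The product of two fibers as a bilinear map. -/
def mulₗ {s t u : G} (h : s * t = u) : B.fiber s →ₗ[ℂ] B.fiber t →ₗ[ℂ] B.fiber u :=
  LinearMap.mk₂ ℂ (B.mul h) (B.add_mul h) (B.smul_mul h) (B.mul_add h) (B.mul_smul h)

/-- The involution on a fiber as an additive map. -/
def invₐ {s t : G} (h : s⁻¹ = t) : B.fiber s →+ B.fiber t :=
  AddMonoidHom.mk' (B.inv h) (B.inv_add h)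

/-- The space `⨁ t, B_t` of finitely supported sections. -/
def Cc : Type (max u v) := ⨁ t, B.fiber t

namespace Cc

instance : AddCommGroup B.Cc := inferInstanceAs (AddCommGroup (⨁ t, B.fiber t))

instance : Module ℂ B.Cc := inferInstanceAs (Module ℂ (⨁ t, B.fiber t))

open Classical in
/-- The section supported at `t` with value `a` there. -/
def of (t : G) : B.fiber t →ₗ[ℂ] B.Cc := DirectSum.lof ℂ G B.fiber t

/-- The value of a section at `t`. -/
def coeff (t : G) : B.Cc →ₗ[ℂ] B.fiber t := DirectSum.component ℂ G B.fiber t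

open Classical in
/-- The linear map on sections defined by a family of linear maps on the fibers. -/
def lift {N : Type*} [AddCommGroup N] [Module ℂ N] (f : ∀ t, B.fiber t →ₗ[ℂ] N) : B.Cc →ₗ[ℂ] N :=
  DirectSum.toModule ℂ G N f

open Classical in
/-- The additive map on sections defined by a family of additive maps on the fibers. -/
def liftAdd {N : Type*} [AddCommGroup N] (f : ∀ t, B.fiber t →+ N) : B.Cc →+ N :=
  DirectSum.toAddMonoid f

variable {B}

@[simp]
theorem lift_of {N : Type*} [AddCommGroup N] [Module ℂ N] (f : ∀ t, B.fiber t →ₗ[ℂ] N) (t : G)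
    (a : B.fiber t) : lift B f (of B t a) = f t a := by
  classical
  exact DirectSum.toModule_lof ℂ t a

@[simp]
theorem liftAdd_of {N : Type*} [AddCommGroup N] (f : ∀ t, B.fiber t →+ N) (t : G)
    (a : B.fiber t) : liftAdd B f (of B t a) = f t a := by
  classical
  exact DirectSum.toAddMonoid_of f t a

@[simp]
theorem coeff_of_same (t : G) (a : B.fiber t) : coeff B t (of B t a) = a := by
  classical
  exact DirectSum.component.lof_self ℂ t a

theorem coeff_of_ne {s t : G} (h : s ≠ t) (a : B.fiber s) : coeff B t (of B s a) = 0 := by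
  classical
  exact (DirectSum.component.of ℂ t s a).trans (dif_neg h)

theorem ext {a b : B.Cc} (h : ∀ t, coeff B t a = coeff B t b) : a = b :=
  DirectSum.ext_component ℂ h

theorem of_injective (t : G) : Function.Injective (of B t) :=
  Function.LeftInverse.injective (coeff_of_same t)

@[elab_as_elim]
theorem induction {p : B.Cc → Prop} (a : B.Cc) (h0 : p 0) (hof : ∀ t (a : B.fiber t), p (of B t a))
    (hadd : ∀ a b, p a → p b → p (a + b)) : p a := by
  classical
  exact DirectSum.induction_on a h0 hof hadd

/-- The convolution product, `(a b)(u) = ∑ a(s) b(t)` over all `s, t` with `s t = u`. -/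
def mulₗ : B.Cc →ₗ[ℂ] B.Cc →ₗ[ℂ] B.Cc :=
  lift B fun s => LinearMap.flip <| lift B fun t => LinearMap.flip <|
    (B.mulₗ (rfl : s * t = s * t)).compr₂ (of B (s * t))

instance : Mul B.Cc := ⟨fun a b => mulₗ a b⟩

theorem of_mul_of {s t u : G} (h : s * t = u) (a : B.fiber s) (b : B.fiber t) :
    of B s a * of B t b = of B u (B.mul h a b) := by
  subst h
  change mulₗ _ _ = _
  simp [mulₗ, FellBundle.mulₗ]

instance : NonUnitalRing B.Cc :=
  { (inferInstance : AddCommGroup B.Cc), (inferInstance : Mul B.Cc) with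
    left_distrib := fun a b c => map_add (mulₗ a) b c
    right_distrib := fun a b c => LinearMap.map_add₂ mulₗ a b c
    zero_mul := fun a => LinearMap.map_zero₂ mulₗ a
    mul_zero := fun a => map_zero (mulₗ a)
    mul_assoc := fun a b c => by
      have zm : ∀ a : B.Cc, 0 * a = 0 := fun a => LinearMap.map_zero₂ mulₗ a
      have mz : ∀ a : B.Cc, a * 0 = 0 := fun a => map_zero (mulₗ a)
      have ld : ∀ a b c : B.Cc, a * (b + c) = a * b + a * c := fun a b c => map_add (mulₗ a) b c
      have rd : ∀ a b c : B.Cc, (a + b) * c = a * c + b * c :=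
        fun a b c => LinearMap.map_add₂ mulₗ a b c
      induction a using Cc.induction with
      | h0 => simp only [zm]
      | hadd a a' h h' => simp only [rd, h, h']
      | hof s a =>
        induction b using Cc.induction with
        | h0 => simp only [zm, mz]
        | hadd b b' h h' => simp only [rd, ld, h, h']
        | hof t b =>
          induction c using Cc.induction with
          | h0 => simp only [mz]
          | hadd c c' h h' => simp only [ld, h, h']
          | hof r c =>
            rw [of_mul_of rfl, of_mul_of rfl, of_mul_of rfl,
              of_mul_of (_root_.mul_assoc s t r).symm, B.mul_assoc] }

instance : IsScalarTower ℂ B.Cc B.Cc where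
  smul_assoc := fun z a b => LinearMap.map_smul₂ mulₗ z a b

instance : SMulCommClass ℂ B.Cc B.Cc where
  smul_comm := fun z a b => (map_smul (mulₗ a) z b).symm

/-- The involution, `a⋆(t) = a(t⁻¹)⋆`. -/
instance : Star B.Cc := ⟨fun a => liftAdd B
  (fun s => (of B s⁻¹).toAddMonoidHom.comp (B.invₐ (rfl : s⁻¹ = s⁻¹))) a⟩

theorem star_of {s t : G} (h : s⁻¹ = t) (a : B.fiber s) :
    star (of B s a) = of B t (B.inv h a) := by
  subst h
  exact liftAdd_of _ s a

theorem star_add' (a b : B.Cc) : star (a + b) = star a + star b := map_add (liftAdd B _) a b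

theorem star_zero' : star (0 : B.Cc) = 0 := map_zero (liftAdd B _)

instance : StarRing B.Cc where
  star_involutive := fun a => by
    induction a using Cc.induction with
    | h0 => rw [star_zero', star_zero']
    | hadd a b h h' => rw [star_add', star_add', h, h']
    | hof s a => rw [star_of rfl, star_of (_root_.inv_inv s), B.inv_inv]
  star_add := star_add'
  star_mul := fun a b => by
    induction a using Cc.induction with
    | h0 => rw [star_zero', zero_mul, mul_zero, star_zero']
    | hadd a a' h h' => rw [_root_.add_mul, star_add', star_add', _root_.mul_add, h, h']
    | hof s a =>
      induction b using Cc.induction with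
      | h0 => rw [star_zero', zero_mul, mul_zero, star_zero']
      | hadd b b' h h' => rw [_root_.mul_add, star_add', star_add', _root_.add_mul, h, h']
      | hof t b =>
        rw [of_mul_of rfl, star_of rfl, star_of rfl, star_of rfl,
          of_mul_of (_root_.mul_inv_rev s t).symm, ← B.inv_mul]

instance : StarModule ℂ B.Cc where
  star_smul := fun z a => by
    induction a using Cc.induction with
    | h0 => rw [smul_zero, star_zero', smul_zero]
    | hadd a b h h' => rw [smul_add, star_add', star_add', smul_add, h, h']
    | hof s a => rw [← map_smul, star_of rfl, star_of rfl, B.inv_smul, map_smul]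

end Cc

end FellBundle

namespace FellBundle

variable {G : Type u} [Group G] {B : FellBundle.{u, v} G}

namespace Cc

theorem coeff_one_mul_of (x : B.Cc) (a : B.fiber 1) :
    coeff B 1 (x * of B 1 a) = coeff B 1 x * a := by
  induction x using Cc.induction with
  | h0 => simp
  | hadd x y h h' => rw [_root_.add_mul, map_add, map_add, h, h', _root_.add_mul]
  | hof t x =>
    rw [of_mul_of (mul_one t)]
    by_cases h : t = 1
    · subst h; rw [coeff_of_same, coeff_of_same]; rfl
    · rw [coeff_of_ne h, coeff_of_ne h, zero_mul]

theorem coeff_star (x : B.Cc) : coeff B 1 (star x) = star (coeff B 1 x) := by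
  induction x using Cc.induction with
  | h0 => simp
  | hadd x y h h' => rw [star_add, map_add, map_add, star_add, h, h']
  | hof t x =>
    rw [star_of rfl]
    by_cases h : t = 1
    · subst h; rw [← star_of rfl, star_of inv_one, coeff_of_same, coeff_of_same]; rfl
    · rw [coeff_of_ne h, coeff_of_ne (inv_ne_one.2 h), star_zero]

/-- The `fiber 1`-valued inner product `⟨x, y⟩ = ∑ x(t)⋆ y(t)` of sections, which is the value of
`x⋆ y` at the unit. -/
def ip (x y : B.Cc) : B.fiber 1 := coeff B 1 (star x * y)

theorem ip_of_left {t : G} (a : B.fiber t) (y : B.Cc) :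
    ip (of B t a) y = B.mul (inv_mul_cancel t) (B.inv rfl a) (coeff B t y) := by
  change _ = B.mulₗ (inv_mul_cancel t) (B.inv rfl a) (coeff B t y)
  rw [ip, star_of rfl]
  induction y using Cc.induction with
  | h0 => simp
  | hadd x y h h' => rw [_root_.mul_add, map_add, map_add, map_add, h, h']
  | hof s y =>
    by_cases h : s = t
    · subst h
      rw [of_mul_of (inv_mul_cancel s), coeff_of_same, coeff_of_same]
      rfl
    · rw [of_mul_of rfl, coeff_of_ne h, map_zero, coeff_of_ne]
      rwa [ne_eq, inv_mul_eq_one, eq_comm]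

theorem ip_add_left (x y z : B.Cc) : ip (x + y) z = ip x z + ip y z := by
  rw [ip, star_add, _root_.add_mul, map_add]; rfl

theorem ip_add_right (x y z : B.Cc) : ip x (y + z) = ip x y + ip x z := by
  rw [ip, _root_.mul_add, map_add]; rfl

theorem exists_support (x : B.Cc) : ∃ S : Finset G, (∀ t ∉ S, coeff B t x = 0) ∧
    x = ∑ t ∈ S, of B t (coeff B t x) := by
  classical
  refine ⟨DFinsupp.support (β := B.fiber) x, fun t ht => ?_, (DirectSum.sum_support_of x).symm⟩
  exact DFinsupp.notMem_support_iff.1 ht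

theorem exists_ip_eq_sum (x : B.Cc) : ∃ S : Finset G, (∀ t ∉ S, coeff B t x = 0) ∧
    ∀ y, ip x y = ∑ t ∈ S, B.mul (inv_mul_cancel t) (B.inv rfl (coeff B t x)) (coeff B t y) := by
  obtain ⟨S, hS, hx⟩ := exists_support x
  refine ⟨S, hS, fun y => ?_⟩
  conv_lhs => rw [hx, ip, star_sum, Finset.sum_mul, map_sum]
  exact Finset.sum_congr rfl fun t _ => ip_of_left _ _

/-- The inner product is given by the usual formula. -/
theorem ip_eq_finsum (x y : B.Cc) : ip x y =
    ∑ᶠ t, B.mul (inv_mul_cancel t) (B.inv rfl (coeff B t x)) (coeff B t y) := by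
  obtain ⟨S, hS, h⟩ := exists_ip_eq_sum x
  rw [h, finsum_eq_sum_of_support_subset]
  intro t ht
  by_contra hn
  refine ht ?_
  change B.mulₗ _ (B.invₐ _ (coeff B t x)) _ = 0
  rw [hS t hn]
  simp

theorem ip_self_nonneg (x : B.Cc) : 0 ≤ ip x x := by
  obtain ⟨S, -, h⟩ := exists_ip_eq_sum x
  rw [h]
  exact Finset.sum_nonneg fun t _ => B.inv_mul_self_nonneg' _ _ _

theorem norm_coeff_sq_le (x : B.Cc) (t : G) : ‖coeff B t x‖ ^ 2 ≤ ‖ip x x‖ := by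
  obtain ⟨S, hS, h⟩ := exists_ip_eq_sum x
  by_cases ht : t ∈ S
  · rw [pow_two, ← B.norm_inv_mul_self rfl (inv_mul_cancel t), h]
    refine CStarAlgebra.norm_le_norm_of_nonneg_of_le (B.inv_mul_self_nonneg' _ _ _) ?_
    exact Finset.single_le_sum (f := fun t =>
      B.mul (inv_mul_cancel t) (B.inv rfl (coeff B t x)) (coeff B t x))
      (fun t _ => B.inv_mul_self_nonneg' _ _ _) ht
  · rw [hS t ht]; simp

theorem ip_self_eq_zero {x : B.Cc} (h : ip x x = 0) : x = 0 := by
  refine ext fun t => ?_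
  have := norm_coeff_sq_le x t
  rw [h, norm_zero] at this
  rw [map_zero, ← norm_eq_zero]
  nlinarith [norm_nonneg (coeff B t x)]

theorem star_ip (x y : B.Cc) : star (ip x y) = ip y x := by
  rw [ip, ← coeff_star, star_mul, star_star]; rfl

theorem ip_mul_of (x y : B.Cc) (a : B.fiber 1) :
    ip x (y * of B 1 a) = ip x y * a := by
  rw [ip, ← _root_.mul_assoc, coeff_one_mul_of]; rfl

theorem of_mul_ip (x y : B.Cc) (a : B.fiber 1) :
    ip (x * of B 1 a) y = star a * ip x y := by
  rw [← star_ip, ip_mul_of, star_mul, star_ip]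

theorem ip_mul_left (a x y : B.Cc) : ip (a * x) y = ip x (star a * y) := by
  rw [ip, ip, star_mul, _root_.mul_assoc]

theorem ip_smul_right (z : ℂ) (x y : B.Cc) : ip x (z • y) = z • ip x y := by
  rw [ip, mul_smul_comm, map_smul]; rfl

theorem ip_smul_left (z : ℂ) (x y : B.Cc) : ip (z • x) y = star z • ip x y := by
  rw [ip, star_smul, smul_mul_assoc, map_smul]; rfl

theorem ip_sub_left (x y z : B.Cc) : ip (x - y) z = ip x z - ip y z := by
  rw [ip, star_sub, _root_.sub_mul, map_sub]; rfl

theorem ip_sub_right (x y z : B.Cc) : ip x (y - z) = ip x y - ip x z := by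
  rw [ip, _root_.mul_sub, map_sub]; rfl

theorem norm_ip_sq_le (x y : B.Cc) : ‖ip x y‖ ^ 2 ≤ ‖ip x x‖ * ‖ip y y‖ := by
  rcases (norm_nonneg (ip x x)).eq_or_lt with h0 | h0
  · have : x = 0 := ip_self_eq_zero (norm_eq_zero.1 h0.symm)
    simp [this, ip]
  set N : ℝ := ‖ip x x‖
  set q := ip x y with hq
  have h1 := ip_self_nonneg (x * of B 1 q - (N : ℂ) • y)
  have h2 : ip (x * of B 1 q - (N : ℂ) • y) (x * of B 1 q - (N : ℂ) • y)
      = star q * ip x x * q - (N : ℂ) • (star q * q) - (N : ℂ) • (star q * q)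
        + (N : ℂ) • (N : ℂ) • ip y y := by
    have e1 : ip y x = star q := by rw [hq, star_ip]
    have e2 : star (N : ℂ) = (N : ℂ) := Complex.conj_ofReal N
    rw [ip_sub_left, ip_sub_right, ip_sub_right, ip_smul_left, ip_smul_left, ip_smul_right,
      ip_smul_right, of_mul_ip, of_mul_ip, ip_mul_of, ip_mul_of, e1, e2, ← hq, _root_.mul_assoc]
    abel
  have h3 : star q * ip x x * q ≤ (N : ℂ) • (star q * q) :=
    CStarAlgebra.star_left_conjugate_le_norm_smul (ip_self_nonneg x).isSelfAdjoint
  rw [h2] at h1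
  have h4 : (N : ℂ) • (star q * q) ≤ (N : ℂ) • (N : ℂ) • ip y y := by
    have := add_le_add h1 h3
    rw [zero_add] at this
    have h5 := sub_le_sub_right this (star q * ip x x * q)
    have h6 := add_nonneg h1 (sub_nonneg.2 h3)
    rw [← sub_nonneg]
    convert h6 using 1
    abel
  have h7 := CStarAlgebra.norm_le_norm_of_nonneg_of_le
    (by
      have : (0 : B.fiber 1) ≤ (N : ℝ) • (star q * q) :=
        smul_nonneg h0.le (star_mul_self_nonneg q)
      exact this) h4
  rw [norm_smul, norm_smul, norm_smul, Complex.norm_real, Real.norm_of_nonneg h0.le,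
    CStarRing.norm_star_mul_self, ← pow_two] at h7
  exact le_of_mul_le_mul_left h7 h0

variable (B) in
/-- The norm `‖⟨x, x⟩‖ ^ (1 / 2)`. -/
def norm₂ (x : B.Cc) : ℝ := √‖ip x x‖

theorem norm₂_nonneg (x : B.Cc) : 0 ≤ norm₂ B x := Real.sqrt_nonneg _

theorem norm₂_sq (x : B.Cc) : norm₂ B x ^ 2 = ‖ip x x‖ := Real.sq_sqrt (norm_nonneg _)

theorem norm₂_smul (z : ℂ) (x : B.Cc) : norm₂ B (z • x) = ‖z‖ * norm₂ B x := by
  rw [norm₂, ip_smul_left, ip_smul_right, norm_smul, norm_smul, norm_star, ← _root_.mul_assoc,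
    Real.sqrt_mul (by positivity), Real.sqrt_mul_self (norm_nonneg z)]; rfl

theorem norm_ip_le (x y : B.Cc) : ‖ip x y‖ ≤ norm₂ B x * norm₂ B y := by
  refine (pow_le_pow_iff_left₀ (norm_nonneg _)
    (mul_nonneg (norm₂_nonneg _) (norm₂_nonneg _)) two_ne_zero).1 ?_
  rw [mul_pow, norm₂_sq, norm₂_sq]
  exact norm_ip_sq_le _ _

theorem norm₂_add_le (x y : B.Cc) : norm₂ B (x + y) ≤ norm₂ B x + norm₂ B y := by
  refine Real.sqrt_le_iff.2 ⟨add_nonneg (norm₂_nonneg _) (norm₂_nonneg _), ?_⟩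
  rw [ip_add_left, ip_add_right, ip_add_right]
  calc _ ≤ ‖ip x x‖ + ‖ip x y‖ + (‖ip y x‖ + ‖ip y y‖) :=
        (norm_add_le _ _).trans (add_le_add (norm_add_le _ _) (norm_add_le _ _))
    _ ≤ (norm₂ B x + norm₂ B y) ^ 2 := by
        rw [← norm₂_sq, ← norm₂_sq]; nlinarith [norm_ip_le x y, norm_ip_le y x]

theorem norm₂_eq_zero_iff (x : B.Cc) : norm₂ B x = 0 ↔ x = 0 := by
  constructor
  · intro h
    have := norm₂_sq x
    rw [h] at this
    exact ip_self_eq_zero (norm_eq_zero.1 (by rw [← this]; simp))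
  · rintro rfl
    simp [norm₂, ip]

theorem norm₂_of {t : G} (a : B.fiber t) : norm₂ B (of B t a) = ‖a‖ := by
  rw [norm₂, ip_of_left, coeff_of_same, B.norm_inv_mul_self, Real.sqrt_mul_self (norm_nonneg _)]

theorem norm_coeff_le_norm₂ (x : B.Cc) (t : G) : ‖coeff B t x‖ ≤ norm₂ B x :=
  Real.le_sqrt_of_sq_le (norm_coeff_sq_le x t)

/-- Multiplication on the left by an element of a fiber is bounded for `norm₂`. -/
theorem ip_of_mul_le {t : G} (a : B.fiber t) (x : B.Cc) :
    ip (of B t a * x) (of B t a * x) ≤ (‖a‖ ^ 2 : ℝ) • ip x x := by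
  obtain ⟨c, hc⟩ := B.inv_mul_self_nonneg rfl (inv_mul_cancel t) a
  rw [← star_def, ← mul_def] at hc
  obtain ⟨l, d, hl, hd⟩ := CStarAux.exists_sqrt c
  have hn : ‖star c * c‖ = ‖a‖ ^ 2 := by
    rw [← hc, B.norm_inv_mul_self, pow_two]
  rw [hn] at hl
  have h0 := ip_self_nonneg (l • x + of B 1 d * x)
  have ha : star (of B t a) * of B t a = of B 1 (star c * c) := by
    rw [star_of rfl, of_mul_of (inv_mul_cancel t), hc]
  have hs : star (of B 1 d) = of B 1 (star d) := star_of inv_one d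
  have hm : ∀ p q : B.fiber 1, of B 1 p * of B 1 q = of B 1 (p * q) :=
    fun p q => of_mul_of (one_mul 1) p q
  have e : star (l • x + of B 1 d * x) * (l • x + of B 1 d * x)
      = (star l * l) • (star x * x) - star (of B t a * x) * (of B t a * x) := by
    have e1 : star (of B t a * x) * (of B t a * x) = star x * of B 1 (star c * c) * x := by
      rw [star_mul, ← ha]; simp only [_root_.mul_assoc]
    have e2 : star (l • x + of B 1 d * x) * (l • x + of B 1 d * x)
        = (star l * l) • (star x * x) + star x * of B 1 (star l • d + l • star d + star d * d) * x := by
      rw [star_add, star_smul, star_mul, hs, map_add, map_add, map_smul, map_smul, ← hm]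
      simp only [_root_.add_mul, _root_.mul_add, smul_mul_assoc, mul_smul_comm,
        _root_.mul_assoc]
      rw [smul_add, smul_comm l (star l), ← smul_smul (star l) l]
      abel
    rw [e2, e1, hd, map_neg, mul_neg, neg_mul, sub_eq_add_neg]
  rw [ip, e, map_sub, map_smul, hl, sub_nonneg] at h0
  exact h0

theorem norm₂_of_mul_le {t : G} (a : B.fiber t) (x : B.Cc) :
    norm₂ B (of B t a * x) ≤ ‖a‖ * norm₂ B x := by
  refine Real.sqrt_le_iff.2 ⟨mul_nonneg (norm_nonneg _) (norm₂_nonneg _), ?_⟩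
  have := CStarAlgebra.norm_le_norm_of_nonneg_of_le (ip_self_nonneg _) (ip_of_mul_le a x)
  rwa [norm_smul, Real.norm_of_nonneg (by positivity), ← norm₂_sq x, ← mul_pow] at this

theorem exists_bound (a : B.Cc) : ∃ C : ℝ, ∀ x : B.Cc, norm₂ B (a * x) ≤ C * norm₂ B x := by
  induction a using Cc.induction with
  | h0 => exact ⟨0, fun x => by rw [zero_mul, zero_mul, (norm₂_eq_zero_iff _).2 rfl]⟩
  | hof t a => exact ⟨‖a‖, norm₂_of_mul_le a⟩
  | hadd a b ha hb =>
    obtain ⟨C, hC⟩ := ha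
    obtain ⟨D, hD⟩ := hb
    refine ⟨C + D, fun x => ?_⟩
    rw [_root_.add_mul, _root_.add_mul]
    exact (norm₂_add_le _ _).trans (add_le_add (hC x) (hD x))

end Cc

variable (B) in
/-- The space of finitely supported sections with the norm `‖x‖ = ‖∑ x(t)⋆ x(t)‖ ^ (1 / 2)`.
Its completion is the Hilbert `fiber 1`-module `ℓ²(B)`. -/
def PreL2 : Type (max u v) := B.Cc

namespace PreL2

instance : AddCommGroup B.PreL2 := inferInstanceAs (AddCommGroup B.Cc)

instance : Module ℂ B.PreL2 := inferInstanceAs (Module ℂ B.Cc)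

instance : Norm B.PreL2 := ⟨Cc.norm₂ B⟩

theorem core : NormedSpace.Core ℂ B.PreL2 where
  norm_nonneg x := Cc.norm₂_nonneg (B := B) x
  norm_smul z x := Cc.norm₂_smul (B := B) z x
  norm_triangle x y := Cc.norm₂_add_le (B := B) x y
  norm_eq_zero_iff x := Cc.norm₂_eq_zero_iff (B := B) x

instance : NormedAddCommGroup B.PreL2 := NormedAddCommGroup.ofCore core

instance : NormedSpace ℂ B.PreL2 := NormedSpace.ofCore core

end PreL2

namespace Cc

/-- The left regular representation of the sections by left multiplication operators on the
(dense part of the) Hilbert module `ℓ²(B)`. -/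
def regularRep : B.Cc →ₙₐ[ℂ] (B.PreL2 →L[ℂ] B.PreL2) where
  toFun a := LinearMap.mkContinuousOfExistsBound (mulₗ a : B.PreL2 →ₗ[ℂ] B.PreL2) (exists_bound a)
  map_smul' z a := ContinuousLinearMap.ext fun x => smul_mul_assoc z a (x : B.Cc)
  map_zero' := ContinuousLinearMap.ext fun x => zero_mul (M₀ := B.Cc) x
  map_add' a b := ContinuousLinearMap.ext fun x => _root_.add_mul a b (x : B.Cc)
  map_mul' a b := ContinuousLinearMap.ext fun x => _root_.mul_assoc a b (x : B.Cc)

theorem regularRep_apply (a x : B.Cc) : regularRep a (x : B.PreL2) = (a * x : B.Cc) := rfl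

theorem norm_regularRep_le (a : B.Cc) {C : ℝ} (hC : 0 ≤ C)
    (h : ∀ x, norm₂ B (a * x) ≤ C * norm₂ B x) : ‖regularRep a‖ ≤ C :=
  ContinuousLinearMap.opNorm_le_bound _ hC h

theorem norm₂_mul_le (a x : B.Cc) : norm₂ B (a * x) ≤ ‖regularRep a‖ * norm₂ B x :=
  ContinuousLinearMap.le_opNorm (regularRep a) x

theorem norm_coeff_le (a : B.Cc) (t : G) : ‖coeff B t a‖ ≤ ‖regularRep a‖ := by
  set b := coeff B t a with hb
  set w : B.fiber 1 := B.mul (inv_mul_cancel t) (B.inv rfl b) b with hw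
  have hwn : ‖w‖ = ‖b‖ ^ 2 := by rw [hw, B.norm_inv_mul_self, pow_two]
  have hws : star w = w := (B.inv_mul_self_nonneg' _ _ b).isSelfAdjoint
  have h1 := norm₂_mul_le a (of B 1 w)
  rw [norm₂_of] at h1
  have h2 := (norm_coeff_le_norm₂ (a * of B 1 w) t).trans h1
  have h3 : ∀ a : B.Cc, coeff B t (a * of B 1 w) = B.mul (mul_one t) (coeff B t a) w := by
    intro a
    change _ = B.mulₗ (mul_one t) (coeff B t a) w
    induction a using Cc.induction with
    | h0 => simp
    | hadd x y h h' => rw [_root_.add_mul, map_add, map_add, map_add, h, h']; rfl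
    | hof s x =>
      rw [of_mul_of (mul_one s)]
      by_cases h : s = t
      · subst h; rw [coeff_of_same, coeff_of_same]; rfl
      · rw [coeff_of_ne h, coeff_of_ne h]; simp
  rw [h3, ← hb] at h2
  have h4 : ‖B.mul (mul_one t) b w‖ ^ 2 = ‖w * w * w‖ := by
    have e : star w * w * w = ip (of B t (B.mul (mul_one t) b w)) (of B t (B.mul (mul_one t) b w)) := by
      rw [← of_mul_of (mul_one t), of_mul_ip, ip_mul_of, ip_of_left, coeff_of_same, _root_.mul_assoc]
    rw [← norm₂_of, norm₂_sq, ← e, hws]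
  have h5 : ‖w‖ ^ 4 ≤ ‖w * w * w‖ * ‖w‖ := by
    have e1 : ‖w * w‖ = ‖w‖ * ‖w‖ := by
      rw [← CStarRing.norm_star_mul_self (x := w), hws]
    have e2 : ‖(w * w) * (w * w)‖ = ‖w * w‖ * ‖w * w‖ := by
      rw [← CStarRing.norm_star_mul_self (x := w * w), star_mul, hws]
    calc ‖w‖ ^ 4 = ‖(w * w) * (w * w)‖ := by rw [e2, e1]; ring
      _ = ‖w * w * w * w‖ := by simp only [_root_.mul_assoc]
      _ ≤ _ := _root_.norm_mul_le _ _
  rw [hwn] at h2 h5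
  have hr := norm_nonneg (regularRep a)
  rcases (norm_nonneg b).eq_or_lt with h0 | h0
  · rw [← h0]; exact hr
  refine (pow_le_pow_iff_left₀ h0.le hr two_ne_zero).1 ?_
  have h6 : ‖w * w * w‖ ≤ (‖regularRep a‖ * ‖b‖ ^ 2) ^ 2 := by
    rw [← h4]; exact pow_le_pow_left₀ (norm_nonneg _) h2 2
  have h7 : ‖b‖ ^ 6 * ‖b‖ ^ 2 ≤ (‖regularRep a‖ ^ 2 * ‖b‖ ^ 4) * ‖b‖ ^ 2 := by
    calc _ = (‖b‖ ^ 2) ^ 4 := by ring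
      _ ≤ _ := h5
      _ ≤ (‖regularRep a‖ * ‖b‖ ^ 2) ^ 2 * ‖b‖ ^ 2 := by gcongr
      _ = _ := by ring
  have h8 := le_of_mul_le_mul_right h7 (by positivity)
  refine le_of_mul_le_mul_right (a := ‖b‖ ^ 4) ?_ (by positivity)
  calc _ = ‖b‖ ^ 6 := by ring
    _ ≤ _ := h8

theorem regularRep_injective : Function.Injective (regularRep (B := B)) := by
  refine (injective_iff_map_eq_zero _).2 fun a ha => ext fun t => ?_
  have := norm_coeff_le a t
  rw [ha, norm_zero] at this
  rw [map_zero, ← norm_le_zero_iff]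
  exact this

/-- The reduced norm `‖a‖ = ‖Λ a‖` on the sections, where `Λ` is the regular representation. -/
instance : NonUnitalNormedRing B.Cc :=
  NonUnitalNormedRing.induced B.Cc (B.PreL2 →L[ℂ] B.PreL2) regularRep regularRep_injective

theorem norm_def (a : B.Cc) : ‖a‖ = ‖regularRep a‖ := rfl

instance : NormedSpace ℂ B.Cc where
  norm_smul_le z a := by rw [norm_def, map_smul, norm_smul]; rfl

instance : CStarRing B.Cc where
  norm_mul_self_le a := by
    have h : ‖a‖ ≤ √‖star a * a‖ := by
      refine norm_regularRep_le a (Real.sqrt_nonneg _) fun x => ?_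
      refine Real.sqrt_le_iff.2 ⟨mul_nonneg (Real.sqrt_nonneg _) (norm₂_nonneg _), ?_⟩
      rw [ip_mul_left, mul_pow, Real.sq_sqrt (norm_nonneg _), ← _root_.mul_assoc]
      calc _ ≤ norm₂ B x * norm₂ B (star a * a * x) := norm_ip_le _ _
        _ ≤ norm₂ B x * (‖star a * a‖ * norm₂ B x) := by
            gcongr
            · exact norm₂_nonneg _
            · exact norm₂_mul_le _ _
        _ = _ := by ring
    calc ‖a‖ * ‖a‖ ≤ √‖star a * a‖ * √‖star a * a‖ := by gcongr
      _ = _ := Real.mul_self_sqrt (norm_nonneg _)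

end Cc

variable (B) in
/-- The reduced cross-sectional C⋆-algebra of a Fell bundle: the completion of the `*`-algebra of
finitely supported sections in the norm `‖Λ a‖`, for the regular representation `Λ`. -/
abbrev Cr : Type (max u v) := CStarCompletion B.Cc

/-- The embedding of the fiber over `t` into the reduced cross-sectional algebra. -/
def incl (B : FellBundle.{u, v} G) (t : G) : B.fiber t →ₗ[ℂ] B.Cr :=
  (CStarCompletion.coeL : B.Cc →L[ℂ] B.Cr).toLinearMap ∘ₗ Cc.of B t

/-- The Fourier coefficient operator `F_t : C*_r(B) → B_t`, the continuous extension of the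
evaluation of sections at `t`. -/
def fourier (B : FellBundle.{u, v} G) (t : G) : B.Cr →L[ℂ] B.fiber t :=
  ((Cc.coeff B t).mkContinuous 1 fun a => by
    rw [one_mul]; exact Cc.norm_coeff_le a t).extend CStarCompletion.coeL

theorem fourier_coe (t : G) (a : B.Cc) :
    B.fourier t (CStarCompletion.coe a) = Cc.coeff B t a :=
  ContinuousLinearMap.extend_eq _ (e := (CStarCompletion.coeL : B.Cc →L[ℂ] B.Cr))
    (UniformSpace.Completion.denseRange_coe) (UniformSpace.Completion.isUniformInducing_coe _) a

end FellBundle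

namespace FellBundle

variable {G : Type u} [Group G] {B : FellBundle.{u, v} G}

/-- The right-hand side is `(1 - u) ⟨x, x⟩ (1 - u)`. -/
theorem Cc.ip_sub_mul (x : B.Cc) {u : B.fiber 1} (hu : star u = u) :
    ip (x - x * of B 1 u) (x - x * of B 1 u)
      = ip x x - ip x x * u - u * ip x x + u * ip x x * u := by
  rw [ip_sub_left, ip_sub_right, ip_sub_right, of_mul_ip, of_mul_ip, ip_mul_of, hu,
    _root_.mul_assoc]
  abel

theorem norm_sub_mul_sq {t : G} (x : B.fiber t) {u : B.fiber 1} (hu : star u = u) :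
    ‖x - B.mul (mul_one t) x u‖ ^ 2 =
      ‖B.mul (inv_mul_cancel t) (B.inv rfl x) x - B.mul (inv_mul_cancel t) (B.inv rfl x) x * u
        - u * B.mul (inv_mul_cancel t) (B.inv rfl x) x
        + u * B.mul (inv_mul_cancel t) (B.inv rfl x) x * u‖ := by
  have e : B.mul (inv_mul_cancel t) (B.inv rfl x) x = Cc.ip (Cc.of B t x) (Cc.of B t x) := by
    rw [Cc.ip_of_left, Cc.coeff_of_same]
  rw [e, ← Cc.ip_sub_mul _ hu, Cc.of_mul_of (mul_one t), ← map_sub, ← Cc.norm₂_of, Cc.norm₂_sq]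

/-- An ideal of a Fell bundle: a family of closed subspaces `J_t ⊆ B_t` with
`B_s J_t ⊆ J_{st}` and `J_s B_t ⊆ J_{st}`. -/
structure Ideal (B : FellBundle.{u, v} G) where
  carrier : ∀ t, Submodule ℂ (B.fiber t)
  isClosed : ∀ t, IsClosed (carrier t : Set (B.fiber t))
  mul_mem_left : ∀ {s t u : G} (h : s * t = u) (a : B.fiber s) {b : B.fiber t},
    b ∈ carrier t → B.mul h a b ∈ carrier u
  mul_mem_right : ∀ {s t u : G} (h : s * t = u) {a : B.fiber s} (b : B.fiber t),
    a ∈ carrier s → B.mul h a b ∈ carrier u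

namespace Ideal

variable (J : B.Ideal)

theorem exists_approx {j : B.fiber 1} (hj : j ∈ J.carrier 1) {ε : ℝ} (hε : 0 < ε) :
    ∃ u ∈ J.carrier 1, star u = u ∧ ‖u‖ ≤ 1 ∧
      ∀ y : B.fiber 1, ‖y - y * u - u * y + u * y * u‖ ≤ ‖y + j‖ + ε := by
  obtain ⟨v, μ, u, hu, h1, h2, h3⟩ := CStarAux.exists_approx j hε
  refine ⟨u, ?_, h1, h2, h3⟩
  have hk : star j * j ∈ J.carrier 1 := J.mul_mem_left _ _ hj
  rw [hu]
  exact add_mem (J.mul_mem_right _ _ hk) (Submodule.smul_mem _ _ hk)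

theorem exists_mul_near {t : G} {x : B.fiber t}
    (hx : B.mul (inv_mul_cancel t) (B.inv rfl x) x ∈ J.carrier 1) {ε : ℝ} (hε : 0 < ε) :
    ∃ u ∈ J.carrier 1, star u = u ∧ ‖x - B.mul (mul_one t) x u‖ < ε := by
  obtain ⟨u, hu, hus, -, h⟩ := J.exists_approx (neg_mem hx) (ε := (ε / 2) ^ 2) (by positivity)
  refine ⟨u, hu, hus, ?_⟩
  have h1 := h (B.mul (inv_mul_cancel t) (B.inv rfl x) x)
  rw [add_neg_cancel, norm_zero, zero_add, ← norm_sub_mul_sq x hus] at h1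
  have := (pow_le_pow_iff_left₀ (norm_nonneg _) (by positivity) two_ne_zero).1 h1
  linarith

theorem mem_of_inv_mul_self_mem {t : G} {x : B.fiber t}
    (hx : B.mul (inv_mul_cancel t) (B.inv rfl x) x ∈ J.carrier 1) : x ∈ J.carrier t := by
  rw [← SetLike.mem_coe, ← (J.isClosed t).closure_eq, Metric.mem_closure_iff]
  intro ε hε
  obtain ⟨u, hu, -, h⟩ := J.exists_mul_near hx hε
  exact ⟨_, J.mul_mem_left _ _ hu, by rwa [dist_eq_norm]⟩

theorem inv_mem {s t : G} (h : s⁻¹ = t) {x : B.fiber s} (hx : x ∈ J.carrier s) :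
    B.inv h x ∈ J.carrier t := by
  subst h
  rw [← SetLike.mem_coe, ← (J.isClosed s⁻¹).closure_eq, Metric.mem_closure_iff]
  intro ε hε
  obtain ⟨u, hu, hus, h⟩ := J.exists_mul_near (J.mul_mem_left (inv_mul_cancel s) (B.inv rfl x) hx) hε
  refine ⟨_, J.mul_mem_right (one_mul s⁻¹) (B.inv rfl x) hu, ?_⟩
  have e : B.inv rfl x - B.mul (one_mul s⁻¹) u (B.inv rfl x)
      = B.inv rfl (x - B.mul (mul_one s) x u) := by
    conv_lhs => rw [← hus, star_def, ← B.inv_mul (mul_one s) rfl inv_one rfl (one_mul s⁻¹)]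
    exact (map_sub (B.invₐ (rfl : s⁻¹ = s⁻¹)) _ _).symm
  rwa [dist_eq_norm, e, B.norm_inv]

instance (t : G) : IsClosed (J.carrier t : Set (B.fiber t)) := J.isClosed t

/-- An ideal of a Fell bundle is a Fell bundle in its own right. -/
abbrev toFellBundle : FellBundle.{u, v} G where
  fiber t := J.carrier t
  completeSpace t := (J.isClosed t).completeSpace_coe
  mul h a b := ⟨B.mul h a b, J.mul_mem_left h a b.2⟩
  inv h a := ⟨B.inv h a, J.inv_mem h a.2⟩
  add_mul h a b c := Subtype.ext (B.add_mul h a b c)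
  mul_add h a b c := Subtype.ext (B.mul_add h a b c)
  smul_mul h z a b := Subtype.ext (B.smul_mul h z a b)
  mul_smul h z a b := Subtype.ext (B.mul_smul h z a b)
  mul_assoc h₁ h₂ h₃ h₄ a b c := Subtype.ext (B.mul_assoc h₁ h₂ h₃ h₄ a b c)
  inv_add h a b := Subtype.ext (B.inv_add h a b)
  inv_smul h z a := Subtype.ext (B.inv_smul h z a)
  inv_inv h h' a := Subtype.ext (B.inv_inv h h' a)
  inv_mul h hs ht hp h' a b := Subtype.ext (B.inv_mul h hs ht hp h' a b)
  norm_mul_le h a b := B.norm_mul_le h a b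
  norm_inv_mul_self h h' a := B.norm_inv_mul_self h h' a
  inv_mul_self_nonneg {s t} h h' a := by
    obtain ⟨c, hc⟩ := B.inv_mul_self_nonneg h h' (a : B.fiber s)
    have hm : B.mul h' (B.inv h a) (a : B.fiber s) ∈ J.carrier 1 := J.mul_mem_left _ _ a.2
    refine ⟨⟨c, J.mem_of_inv_mul_self_mem ?_⟩, Subtype.ext hc⟩
    rw [hc] at hm
    have : ∀ {t : G} (h : (1 : G)⁻¹ = t) (h' : t * 1 = 1),
        B.mul h' (B.inv h c) c = B.mul (one_mul 1) (B.inv inv_one c) c := by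
      intro t h h'
      have : t = 1 := by rw [← h, inv_one]
      subst this
      rfl
    rwa [this]

/-- The product of the quotient bundle, `(a + J_s) (b + J_t) = a b + J_{st}`. -/
def qmul {s t u : G} (h : s * t = u) (a : B.fiber s ⧸ J.carrier s) (b : B.fiber t ⧸ J.carrier t) :
    B.fiber u ⧸ J.carrier u :=
  Submodule.liftQ (J.carrier s)
    (LinearMap.flip (Submodule.liftQ (J.carrier t)
      (LinearMap.flip ((B.mulₗ h).compr₂ (J.carrier u).mkQ))
      (fun b hb => LinearMap.ext fun a =>
        (Submodule.Quotient.mk_eq_zero _).2 (J.mul_mem_left h a hb))))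
    (fun a ha => LinearMap.ext fun b => by
      obtain ⟨b, rfl⟩ := Submodule.Quotient.mk_surjective _ b
      exact (Submodule.Quotient.mk_eq_zero _).2 (J.mul_mem_right h b ha)) a b

theorem qmul_mk {s t u : G} (h : s * t = u) (a : B.fiber s) (b : B.fiber t) :
    J.qmul h (Submodule.Quotient.mk a) (Submodule.Quotient.mk b)
      = Submodule.Quotient.mk (B.mul h a b) := rfl

/-- The involution of the quotient bundle, `(a + J_s)⋆ = a⋆ + J_{s⁻¹}`. -/
def qinv {s t : G} (h : s⁻¹ = t) (a : B.fiber s ⧸ J.carrier s) : B.fiber t ⧸ J.carrier t :=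
  QuotientAddGroup.map (J.carrier s).toAddSubgroup (J.carrier t).toAddSubgroup (B.invₐ h)
    (fun _ ha => J.inv_mem h ha) a

theorem qinv_mk {s t : G} (h : s⁻¹ = t) (a : B.fiber s) :
    J.qinv h (Submodule.Quotient.mk a) = Submodule.Quotient.mk (B.inv h a) := rfl

theorem norm_qmul_le {s t u : G} (h : s * t = u) (a : B.fiber s ⧸ J.carrier s)
    (b : B.fiber t ⧸ J.carrier t) : ‖J.qmul h a b‖ ≤ ‖a‖ * ‖b‖ := by
  have key : ∀ ε : ℝ, 0 < ε → ‖J.qmul h a b‖ ≤ (‖a‖ + ε) * (‖b‖ + ε) := by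
    intro ε hε
    obtain ⟨x, rfl, hx⟩ := Submodule.Quotient.norm_mk_lt a hε
    obtain ⟨y, rfl, hy⟩ := Submodule.Quotient.norm_mk_lt b hε
    rw [qmul_mk]
    calc _ ≤ ‖B.mul h x y‖ := Submodule.Quotient.norm_mk_le _ _
      _ ≤ ‖x‖ * ‖y‖ := B.norm_mul_le _ _ _
      _ ≤ _ := by gcongr
  have hc : Filter.Tendsto (fun ε : ℝ => (‖a‖ + ε) * (‖b‖ + ε)) (nhdsWithin 0 (Set.Ioi 0))
      (nhds (‖a‖ * ‖b‖)) := by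
    have : Continuous fun ε : ℝ => (‖a‖ + ε) * (‖b‖ + ε) := by fun_prop
    simpa using (this.tendsto 0).mono_left nhdsWithin_le_nhds
  exact ge_of_tendsto hc (Filter.eventually_of_mem self_mem_nhdsWithin key)

theorem norm_qinv_le {s t : G} (h : s⁻¹ = t) (a : B.fiber s ⧸ J.carrier s) :
    ‖J.qinv h a‖ ≤ ‖a‖ := by
  refine le_of_forall_pos_le_add fun ε hε => ?_
  obtain ⟨x, rfl, hx⟩ := Submodule.Quotient.norm_mk_lt a hε
  rw [qinv_mk]
  calc _ ≤ ‖B.inv h x‖ := Submodule.Quotient.norm_mk_le _ _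
    _ = ‖x‖ := B.norm_inv _ _
    _ ≤ _ := hx.le

theorem norm_mk_sq_le {s : G} (x : B.fiber s) :
    ‖(Submodule.Quotient.mk x : B.fiber s ⧸ J.carrier s)‖ ^ 2 ≤
      ‖(Submodule.Quotient.mk (B.mul (inv_mul_cancel s) (B.inv rfl x) x) :
        B.fiber 1 ⧸ J.carrier 1)‖ := by
  refine le_of_forall_pos_le_add fun ε hε => ?_
  obtain ⟨y, hy, hyn⟩ := Submodule.Quotient.norm_mk_lt
    (Submodule.Quotient.mk (B.mul (inv_mul_cancel s) (B.inv rfl x) x) :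
        B.fiber 1 ⧸ J.carrier 1) (half_pos hε)
  have hj := (Submodule.Quotient.eq _).1 hy
  obtain ⟨u, hu, hus, -, h⟩ := J.exists_approx hj (half_pos hε)
  have h1 := h (B.mul (inv_mul_cancel s) (B.inv rfl x) x)
  rw [← norm_sub_mul_sq x hus, add_sub_cancel] at h1
  have e : (Submodule.Quotient.mk x : B.fiber s ⧸ J.carrier s)
      = Submodule.Quotient.mk (x - B.mul (mul_one s) x u) := by
    rw [Submodule.Quotient.eq, sub_sub_cancel]
    exact J.mul_mem_left _ _ hu
  calc _ ≤ ‖x - B.mul (mul_one s) x u‖ ^ 2 := by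
        rw [e]; gcongr; exact Submodule.Quotient.norm_mk_le _ _
    _ ≤ _ := by linarith

/-- The quotient Fell bundle with fibers `B_t / J_t`. -/
abbrev quotient : FellBundle.{u, v} G where
  fiber t := B.fiber t ⧸ J.carrier t
  mul h a b := J.qmul h a b
  inv h a := J.qinv h a
  add_mul h a b c := by simp only [qmul, map_add, LinearMap.add_apply]
  mul_add h a b c := by simp only [qmul, map_add]
  smul_mul h z a b := by simp only [qmul, map_smul, LinearMap.smul_apply]
  mul_smul h z a b := by simp only [qmul, map_smul]
  mul_assoc h₁ h₂ h₃ h₄ a b c := by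
    obtain ⟨a, rfl⟩ := Submodule.Quotient.mk_surjective _ a
    obtain ⟨b, rfl⟩ := Submodule.Quotient.mk_surjective _ b
    obtain ⟨c, rfl⟩ := Submodule.Quotient.mk_surjective _ c
    rw [qmul_mk, qmul_mk, qmul_mk, qmul_mk, B.mul_assoc h₁ h₂ h₃ h₄]
  inv_add h a b := by simp only [qinv]; exact map_add _ _ _
  inv_smul h z a := by
    obtain ⟨a, rfl⟩ := Submodule.Quotient.mk_surjective _ a
    rw [← Submodule.Quotient.mk_smul, qinv_mk, qinv_mk, B.inv_smul, Submodule.Quotient.mk_smul]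
  inv_inv h h' a := by
    obtain ⟨a, rfl⟩ := Submodule.Quotient.mk_surjective _ a
    rw [qinv_mk, qinv_mk, B.inv_inv]
  inv_mul h hs ht hp h' a b := by
    obtain ⟨a, rfl⟩ := Submodule.Quotient.mk_surjective _ a
    obtain ⟨b, rfl⟩ := Submodule.Quotient.mk_surjective _ b
    rw [qmul_mk, qinv_mk, qinv_mk, qinv_mk, qmul_mk, B.inv_mul h hs ht hp h']
  norm_mul_le h a b := J.norm_qmul_le h a b
  norm_inv_mul_self {s t} h h' a := by
    refine le_antisymm ((J.norm_qmul_le _ _ _).trans ?_) ?_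
    · gcongr
      exact J.norm_qinv_le h a
    · obtain ⟨a, rfl⟩ := Submodule.Quotient.mk_surjective _ a
      subst h
      rw [← pow_two]
      exact J.norm_mk_sq_le a
  inv_mul_self_nonneg {s t} h h' a := by
    obtain ⟨a, rfl⟩ := Submodule.Quotient.mk_surjective _ a
    obtain ⟨c, hc⟩ := B.inv_mul_self_nonneg h h' a
    refine ⟨Submodule.Quotient.mk c, ?_⟩
    rw [qinv_mk, qmul_mk, qinv_mk, qmul_mk, hc]

/-- The inclusion of the sections of an ideal, on the level of `*`-algebras. -/
def ιc : J.toFellBundle.Cc →⋆ₙₐ[ℂ] B.Cc where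
  toFun := Cc.lift J.toFellBundle fun t => Cc.of B t ∘ₗ (J.carrier t).subtype
  map_smul' z a := map_smul _ z a
  map_zero' := map_zero _
  map_add' a b := map_add _ a b
  map_mul' a b := by
    induction a using Cc.induction with
    | h0 => simp
    | hadd a a' h h' => rw [_root_.add_mul, map_add, map_add, _root_.add_mul, h, h']
    | hof s a =>
      induction b using Cc.induction with
      | h0 => simp
      | hadd b b' h h' => rw [_root_.mul_add, map_add, map_add, _root_.mul_add, h, h']
      | hof t b =>
        rw [Cc.of_mul_of rfl, Cc.lift_of, Cc.lift_of, Cc.lift_of]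
        exact (Cc.of_mul_of rfl _ _).symm
  map_star' a := by
    induction a using Cc.induction with
    | h0 => simp
    | hadd a a' h h' => rw [star_add, map_add, map_add, star_add, h, h']
    | hof s a =>
      rw [Cc.star_of rfl, Cc.lift_of, Cc.lift_of]
      exact (Cc.star_of rfl _).symm

/-- The quotient map of the sections, on the level of `*`-algebras. -/
def κc : B.Cc →⋆ₙₐ[ℂ] J.quotient.Cc where
  toFun := Cc.lift B fun t => Cc.of J.quotient t ∘ₗ (J.carrier t).mkQ
  map_smul' z a := map_smul _ z a
  map_zero' := map_zero _
  map_add' a b := map_add _ a b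
  map_mul' a b := by
    induction a using Cc.induction with
    | h0 => simp
    | hadd a a' h h' => rw [_root_.add_mul, map_add, map_add, _root_.add_mul, h, h']
    | hof s a =>
      induction b using Cc.induction with
      | h0 => simp
      | hadd b b' h h' => rw [_root_.mul_add, map_add, map_add, _root_.mul_add, h, h']
      | hof t b =>
        rw [Cc.of_mul_of rfl, Cc.lift_of, Cc.lift_of, Cc.lift_of]
        exact (Cc.of_mul_of (B := J.quotient) rfl (Submodule.Quotient.mk a)
          (Submodule.Quotient.mk b)).symm
  map_star' a := by
    induction a using Cc.induction with
    | h0 => simp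
    | hadd a a' h h' => rw [star_add, map_add, map_add, star_add, h, h']
    | hof s a =>
      rw [Cc.star_of rfl, Cc.lift_of, Cc.lift_of]
      exact (Cc.star_of (B := J.quotient) rfl (Submodule.Quotient.mk a)).symm

theorem ιc_of {t : G} (a : J.toFellBundle.fiber t) :
    J.ιc (Cc.of J.toFellBundle t a) = Cc.of B t (a : B.fiber t) :=
  Cc.lift_of (B := J.toFellBundle) (fun t => Cc.of B t ∘ₗ (J.carrier t).subtype) t a

theorem κc_of {t : G} (a : B.fiber t) :
    J.κc (Cc.of B t a) = Cc.of J.quotient t (Submodule.Quotient.mk a) :=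
  Cc.lift_of (fun t => Cc.of J.quotient t ∘ₗ (J.carrier t).mkQ) t a

theorem coeff_ιc (t : G) (a : J.toFellBundle.Cc) :
    Cc.coeff B t (J.ιc a) = (Cc.coeff J.toFellBundle t a : B.fiber t) := by
  induction a using Cc.induction with
  | h0 => simp
  | hadd a b h h' => rw [map_add, map_add, map_add, h, h']; rfl
  | hof s a =>
    rw [ιc_of]
    by_cases h : s = t
    · subst h; rw [Cc.coeff_of_same, Cc.coeff_of_same]
    · rw [Cc.coeff_of_ne h, Cc.coeff_of_ne h]; rfl

theorem coeff_κc (t : G) (a : B.Cc) :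
    Cc.coeff J.quotient t (J.κc a) = Submodule.Quotient.mk (Cc.coeff B t a) := by
  induction a using Cc.induction with
  | h0 => simp
  | hadd a b h h' => rw [map_add, map_add, map_add, h, h']; rfl
  | hof s a =>
    rw [κc_of]
    by_cases h : s = t
    · subst h; rw [Cc.coeff_of_same, Cc.coeff_of_same]
    · rw [Cc.coeff_of_ne h, Cc.coeff_of_ne h]; rfl

theorem norm₂_ιc (a : J.toFellBundle.Cc) : Cc.norm₂ B (J.ιc a) = Cc.norm₂ J.toFellBundle a := by
  rw [Cc.norm₂, Cc.norm₂, Cc.ip, Cc.ip, ← map_star, ← map_mul, coeff_ιc]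
  rfl

theorem norm₂_κc_sq (a : B.Cc) : Cc.norm₂ J.quotient (J.κc a) ^ 2 =
    ‖(Submodule.Quotient.mk (Cc.ip a a) : B.fiber 1 ⧸ J.carrier 1)‖ := by
  rw [Cc.norm₂_sq, Cc.ip, Cc.ip, ← map_star, ← map_mul, coeff_κc]

theorem κc_surjective : Function.Surjective J.κc := by
  intro a
  induction a using Cc.induction with
  | h0 => exact ⟨0, map_zero _⟩
  | hadd a b h h' =>
    obtain ⟨x, rfl⟩ := h
    obtain ⟨y, rfl⟩ := h'
    exact ⟨x + y, map_add _ x y⟩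
  | hof s a =>
    obtain ⟨a, rfl⟩ := Submodule.Quotient.mk_surjective _ a
    exact ⟨Cc.of B s a, J.κc_of a⟩

theorem norm_κc_le (a : B.Cc) : ‖J.κc a‖ ≤ ‖a‖ := by
  refine Cc.norm_regularRep_le _ (norm_nonneg a) fun X => ?_
  obtain ⟨x, rfl⟩ := J.κc_surjective X
  refine (pow_le_pow_iff_left₀ (Cc.norm₂_nonneg _)
    (mul_nonneg (norm_nonneg a) (Cc.norm₂_nonneg _)) two_ne_zero).1 ?_
  rw [← map_mul, mul_pow, J.norm₂_κc_sq x]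
  have key : ∀ ε : ℝ, 0 < ε → Cc.norm₂ J.quotient (J.κc (a * x)) ^ 2 ≤
      ‖a‖ ^ 2 * (‖(Submodule.Quotient.mk (Cc.ip x x) : B.fiber 1 ⧸ J.carrier 1)‖ + ε) := by
    intro ε hε
    obtain ⟨y, hy, hyn⟩ := Submodule.Quotient.norm_mk_lt
      (Submodule.Quotient.mk (Cc.ip x x) : B.fiber 1 ⧸ J.carrier 1) (half_pos hε)
    have hj := (Submodule.Quotient.eq _).1 hy
    obtain ⟨u, hu, hus, -, h⟩ := J.exists_approx hj (half_pos hε)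
    have h1 := h (Cc.ip x x)
    rw [← Cc.ip_sub_mul x hus, add_sub_cancel, ← Cc.norm₂_sq] at h1
    have hz : J.κc (Cc.of B 1 u) = 0 := by
      rw [κc_of, (Submodule.Quotient.mk_eq_zero _).2 hu, map_zero]
    have e : J.κc (a * x) = J.κc (a * (x - x * Cc.of B 1 u)) := by
      rw [map_mul, map_mul, map_sub, map_mul J.κc x, hz, mul_zero, sub_zero]
    have h2 := Cc.norm₂_mul_le a (x - x * Cc.of B 1 u)
    calc _ ≤ Cc.norm₂ B (a * (x - x * Cc.of B 1 u)) ^ 2 := by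
          rw [e, norm₂_κc_sq, Cc.norm₂_sq]; exact Submodule.Quotient.norm_mk_le _ _
      _ ≤ (‖a‖ * Cc.norm₂ B (x - x * Cc.of B 1 u)) ^ 2 := by
          gcongr
          · exact Cc.norm₂_nonneg _
          · exact h2
      _ = ‖a‖ ^ 2 * Cc.norm₂ B (x - x * Cc.of B 1 u) ^ 2 := mul_pow _ _ _
      _ ≤ _ := by gcongr; linarith
  have hc : Filter.Tendsto (fun ε : ℝ => ‖a‖ ^ 2 *
      (‖(Submodule.Quotient.mk (Cc.ip x x) : B.fiber 1 ⧸ J.carrier 1)‖ + ε))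
      (nhdsWithin 0 (Set.Ioi 0)) (nhds (‖a‖ ^ 2 *
      ‖(Submodule.Quotient.mk (Cc.ip x x) : B.fiber 1 ⧸ J.carrier 1)‖)) := by
    have : Continuous fun ε : ℝ => ‖a‖ ^ 2 *
      (‖(Submodule.Quotient.mk (Cc.ip x x) : B.fiber 1 ⧸ J.carrier 1)‖ + ε) := by fun_prop
    simpa using (this.tendsto 0).mono_left nhdsWithin_le_nhds
  exact ge_of_tendsto hc (Filter.eventually_of_mem self_mem_nhdsWithin key)

theorem coeff_ιc_mul_mem (a : J.toFellBundle.Cc) (x : B.Cc) (t : G) :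
    Cc.coeff B t (J.ιc a * x) ∈ J.carrier t := by
  induction a using Cc.induction with
  | h0 => simp
  | hadd a b h h' => rw [map_add, _root_.add_mul, map_add]; exact add_mem h h'
  | hof s a =>
    induction x using Cc.induction with
    | h0 => simp
    | hadd a b h h' => rw [_root_.mul_add, map_add]; exact add_mem h h'
    | hof r x =>
      rw [ιc_of, Cc.of_mul_of rfl]
      by_cases h : s * r = t
      · subst h; rw [Cc.coeff_of_same]; exact J.mul_mem_right _ _ a.2
      · rw [Cc.coeff_of_ne h]; exact zero_mem _

theorem exists_ιc_eq_mul_of (x : B.Cc) {u : B.fiber 1} (hu : u ∈ J.carrier 1) :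
    ∃ y, J.ιc y = x * Cc.of B 1 u := by
  induction x using Cc.induction with
  | h0 => exact ⟨0, by rw [map_zero, zero_mul]⟩
  | hadd a b h h' =>
    obtain ⟨x, hx⟩ := h
    obtain ⟨y, hy⟩ := h'
    exact ⟨x + y, by rw [map_add, hx, hy, _root_.add_mul]⟩
  | hof s x =>
    exact ⟨Cc.of J.toFellBundle s ⟨B.mul (mul_one s) x u, J.mul_mem_left _ _ hu⟩, by
      rw [ιc_of, Cc.of_mul_of (mul_one s)]⟩

theorem norm_ιc_le (a : J.toFellBundle.Cc) : ‖J.ιc a‖ ≤ ‖a‖ := by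
  refine Cc.norm_regularRep_le _ (norm_nonneg a) fun x => ?_
  refine le_of_forall_pos_le_add fun ε hε => ?_
  have hk : Cc.ip (J.ιc a * x) (J.ιc a * x) ∈ J.carrier 1 := by
    obtain ⟨S, -, h⟩ := Cc.exists_ip_eq_sum (J.ιc a * x)
    rw [h]
    exact sum_mem fun t _ => J.mul_mem_left _ _ (J.coeff_ιc_mul_mem a x t)
  obtain ⟨u, hu, hus, hu1, h⟩ := J.exists_approx (neg_mem hk) (ε := ε ^ 2) (by positivity)
  have h1 := h (Cc.ip (J.ιc a * x) (J.ιc a * x))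
  rw [add_neg_cancel, norm_zero, zero_add, ← Cc.ip_sub_mul _ hus, ← Cc.norm₂_sq] at h1
  have h2 := (pow_le_pow_iff_left₀ (Cc.norm₂_nonneg _) hε.le two_ne_zero).1 h1
  obtain ⟨y, hy⟩ := J.exists_ιc_eq_mul_of x hu
  have h3 : Cc.norm₂ B (x * Cc.of B 1 u) ≤ Cc.norm₂ B x := by
    refine (pow_le_pow_iff_left₀ (Cc.norm₂_nonneg _) (Cc.norm₂_nonneg _) two_ne_zero).1 ?_
    rw [Cc.norm₂_sq, Cc.norm₂_sq, Cc.of_mul_ip, Cc.ip_mul_of, hus]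
    calc _ ≤ ‖u‖ * (‖Cc.ip x x‖ * ‖u‖) :=
          (_root_.norm_mul_le _ _).trans (by gcongr; exact _root_.norm_mul_le _ _)
      _ ≤ 1 * (‖Cc.ip x x‖ * 1) := by gcongr
      _ = _ := by ring
  have h4 : Cc.norm₂ B (J.ιc a * x * Cc.of B 1 u) ≤ ‖a‖ * Cc.norm₂ B x := by
    rw [_root_.mul_assoc, ← hy, ← map_mul, norm₂_ιc]
    refine (Cc.norm₂_mul_le a y).trans ?_
    rw [← hy, norm₂_ιc] at h3
    exact mul_le_mul_of_nonneg_left h3 (norm_nonneg a)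
  calc _ = Cc.norm₂ B ((J.ιc a * x - J.ιc a * x * Cc.of B 1 u) + J.ιc a * x * Cc.of B 1 u) := by
        rw [sub_add_cancel]
    _ ≤ _ := Cc.norm₂_add_le _ _
    _ ≤ _ := by linarith

/-- The homomorphism `ι_r : C*_r(J) → C*_r(B)` induced by the inclusion of an ideal. -/
def ιr : J.toFellBundle.Cr →⋆ₙₐ[ℂ] B.Cr := CStarCompletion.map J.ιc J.norm_ιc_le

/-- The homomorphism `κ_r : C*_r(B) → C*_r(B/J)` induced by the quotient map. -/
def κr : B.Cr →⋆ₙₐ[ℂ] J.quotient.Cr := CStarCompletion.map J.κc J.norm_κc_le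

end Ideal

/-- A Fell bundle `B` is exact if `0 → C*_r(J) → C*_r(B) → C*_r(B/J) → 0` is exact for every
ideal `J` of `B`. -/
def IsExact (B : FellBundle.{u, v} G) : Prop :=
  ∀ J : B.Ideal, Function.Injective J.ιr ∧ Function.Exact J.ιr J.κr ∧ Function.Surjective J.κr

/-- A linear subspace `J` of `C*_r(B)` is an ideal: it is closed and two-sided. -/
structure IsIdeal (J : Submodule ℂ B.Cr) : Prop where
  isClosed : IsClosed (J : Set B.Cr)
  mul_mem_left : ∀ a b : B.Cr, b ∈ J → a * b ∈ J
  mul_mem_right : ∀ a b : B.Cr, a ∈ J → a * b ∈ J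

/-- `J` is graded if it is the closed linear span of the subspaces `J ∩ B_t`. -/
def IsGraded (J : Submodule ℂ B.Cr) : Prop :=
  J = (⨆ t, J ⊓ LinearMap.range (B.incl t)).topologicalClosure

/-- `J` is a Fourier ideal if `F_t(J) ⊆ J` for all `t`. -/
def IsFourier (J : Submodule ℂ B.Cr) : Prop :=
  ∀ t, ∀ b ∈ J, B.incl t (B.fourier t b) ∈ J

end FellBundle

end

/-! An ideal `J = {J_t}` of the bundle determines two closed ideals of `C*_r(B)`: the range of
`ι_r`, which is the closed span of the `J_t`, and the kernel of `κ_r`, which consists of all `d`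
with `F_t(d) ∈ J_t` for every `t`. The first is always contained in the second. Injectivity of `ι_r`
and surjectivity of `κ_r` hold for every bundle, so exactness says precisely that the two ideals
coincide for every `J`.

If `I` is a Fourier ideal of `C*_r(B)` and `J_t = I ∩ B_t`, then `I` lies between the two: it
contains the closed span of the `J_t` because it is closed, and it lies in the kernel of `κ_r`
because `F_t(I) ⊆ I ∩ B_t`. If the bundle is exact, the two extremes agree and `I` is graded
(`IsExact.isGraded`). Conversely, the kernel of `κ_r` is itself a Fourier ideal whose intersection
with `B_t` is `J_t`; if it is graded, it is the closed span of the `J_t`, that is, the range of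
`ι_r` (`kerκr_le_range_ιr`).

The description of the kernel, `κr_eq_zero_iff`, carries both directions. It rests on
`eq_zero_of_fourier_eq_zero`, applied in the quotient bundle: an element of a reduced algebra with
vanishing Fourier coefficients is zero. The automatic parts of exactness come from `norm_ιc`, which
makes `ι_r` isometric with closed range, and from the fact that a `*`-homomorphism of C⋆-algebras
with dense range is onto. -/

noncomputable section

/-! ### Surjectivity of `*`-homomorphisms with dense range. -/

namespace NonUnitalStarAlgHom

variable {A B : Type*} [NonUnitalCStarAlgebra A] [NonUnitalCStarAlgebra B]

/-- A self-adjoint element of the range of a `*`-homomorphism has a preimage of no larger norm. -/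
theorem exists_map_eq_norm_le_of_isSelfAdjoint (φ : A →⋆ₙₐ[ℂ] B) {a : A} (ha : IsSelfAdjoint a) :
    ∃ a', φ a' = φ a ∧ ‖a'‖ ≤ ‖φ a‖ := by
  have hb : IsSelfAdjoint (φ a) := ha.map φ
  -- Truncation of the spectrum to `[-‖φ a‖, ‖φ a‖]`. The function fixes `0`, as the non-unital
  -- calculus requires, and is the identity on the spectrum of `φ a`; applied to `a`, it therefore
  -- shortens `a` without changing its image.
  have hf : Continuous fun z : ℝ => max (-‖φ a‖) (min z ‖φ a‖) := by fun_prop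
  have hf0 : max (-‖φ a‖) (min 0 ‖φ a‖) = 0 := by
    rw [min_eq_left (norm_nonneg _), max_eq_right (neg_nonpos.2 (norm_nonneg _))]
  refine ⟨cfcₙ (fun z : ℝ => max (-‖φ a‖) (min z ‖φ a‖)) a, ?_, ?_⟩
  · have hφ : Continuous φ := AddMonoidHomClass.continuous_of_bound φ 1 fun a => by
      simpa only [one_mul] using NonUnitalStarAlgHom.norm_apply_le φ a
    rw [φ.map_cfcₙ (R := ℝ) (S := ℂ) _ a hf.continuousOn hf0 hφ ha hb]
    conv_rhs => rw [← cfcₙ_id' ℝ (φ a) hb]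
    refine cfcₙ_congr fun z hz => ?_
    have hz' : ‖z‖ ≤ ‖φ a‖ := by
      have := norm_apply_le_norm_cfcₙ (fun z : ℝ => z) (φ a) hz
      rwa [cfcₙ_id' ℝ (φ a) hb] at this
    obtain ⟨h1, h2⟩ := abs_le.1 hz'
    change max (-‖φ a‖) (min z ‖φ a‖) = z
    rw [min_eq_left h2, max_eq_right h1]
  · refine norm_cfcₙ_le fun z _ => abs_le.2 ⟨le_max_left _ _, max_le ?_ (min_le_right _ _)⟩
    exact neg_le_self (norm_nonneg _)

/-- Real and imaginary parts are lifted separately, which costs the factor 2. The value of the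
constant is irrelevant: any uniform bound makes successive approximation work. -/
theorem exists_map_eq_norm_le (φ : A →⋆ₙₐ[ℂ] B) (a : A) :
    ∃ a', φ a' = φ a ∧ ‖a'‖ ≤ 2 * ‖φ a‖ := by
  obtain ⟨x, hx, hxn⟩ := φ.exists_map_eq_norm_le_of_isSelfAdjoint (realPart a).2
  obtain ⟨y, hy, hyn⟩ := φ.exists_map_eq_norm_le_of_isSelfAdjoint (imaginaryPart a).2
  have h1 : φ (realPart a) = realPart (φ a) := by
    simp only [realPart_apply_coe, ← map_star, ← map_add]
    -- The factor `1/2` in the real part is a real scalar; it is turned into a complex one because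
    -- `φ` is linear over `ℂ`.
    rw [← Complex.coe_smul, ← Complex.coe_smul, map_smul]
  have h2 : φ (imaginaryPart a) = imaginaryPart (φ a) := by
    simp only [imaginaryPart_apply_coe, ← map_star, ← map_sub]
    rw [← Complex.coe_smul, ← Complex.coe_smul, map_smul, map_smul]
  have h3 : ‖y‖ ≤ ‖φ a‖ := hyn.trans (by rw [h2]; exact imaginaryPart.norm_le (φ a))
  have h4 : ‖x‖ ≤ ‖φ a‖ := hxn.trans (by rw [h1]; exact realPart.norm_le (φ a))
  refine ⟨x + Complex.I • y, ?_, ?_⟩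
  · rw [map_add, map_smul, hx, hy, ← map_smul, ← map_add, realPart_add_I_smul_imaginaryPart]
  · refine (norm_add_le _ _).trans ?_
    rw [norm_smul, Complex.norm_I]
    linarith

/-- A `*`-homomorphism of C⋆-algebras with dense range is surjective. -/
theorem surjective_of_denseRange (φ : A →⋆ₙₐ[ℂ] B) (h : DenseRange φ) :
    Function.Surjective φ := by
  let f : NormedAddGroupHom A B := (φ : A →+ B).mkNormedAddGroupHom 1 fun a => by
    simpa using NonUnitalStarAlgHom.norm_apply_le φ a
  have hf : ∀ a, f a = φ a := fun _ => rfl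
  have h1 : f.SurjectiveOnWith f.range 2 := by
    rintro _ ⟨a, rfl⟩
    exact φ.exists_map_eq_norm_le a
  intro b
  -- Successive approximation in the complete space `A`: bounded lifting with constant 2 on the
  -- range gives lifting with constant `2 + 1` on its closure, which is all of `B`.
  obtain ⟨a, ha, -⟩ := controlled_closure_of_complete two_pos one_pos h1 b
    (by rw [← SetLike.mem_coe, AddSubgroup.topologicalClosure_coe]; exact h b)
  exact ⟨a, ha⟩

end NonUnitalStarAlgHom

/-! ### Fourier coefficients and multiplication by elements of the fibers. -/

namespace FellBundle

variable {G : Type u} [Group G] {B : FellBundle.{u, v} G}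

open CStarCompletion

theorem continuous_mul_left {s t u : G} (h : s * t = u) (a : B.fiber s) :
    Continuous fun b : B.fiber t => B.mul h a b :=
  AddMonoidHomClass.continuous_of_bound (B.mulₗ h a) ‖a‖ fun b => B.norm_mul_le h a b

theorem continuous_mul_right {s t u : G} (h : s * t = u) (b : B.fiber t) :
    Continuous fun a : B.fiber s => B.mul h a b :=
  AddMonoidHomClass.continuous_of_bound ((B.mulₗ h).flip b) ‖b‖ fun a =>
    (B.norm_mul_le h a b).trans_eq (mul_comm _ _)

theorem mul_zero' {s t u : G} (h : s * t = u) (a : B.fiber s) : B.mul h a 0 = 0 :=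
  map_zero (B.mulₗ h a)

theorem zero_mul' {s t u : G} (h : s * t = u) (b : B.fiber t) : B.mul h 0 b = 0 :=
  LinearMap.map_zero₂ (B.mulₗ h) b

theorem Cc.coeff_of_mul {s t u : G} (h : s * t = u) (a : B.fiber s) (x : B.Cc) :
    coeff B u (of B s a * x) = B.mul h a (coeff B t x) := by
  induction x using Cc.induction with
  | h0 => rw [mul_zero, map_zero, map_zero, mul_zero']
  | hadd x y hx hy => rw [_root_.mul_add, map_add, map_add, hx, hy, B.mul_add]
  | hof r x =>
    by_cases hr : r = t
    · subst hr; rw [of_mul_of h, coeff_of_same, coeff_of_same]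
    · rw [of_mul_of rfl, coeff_of_ne hr, mul_zero', coeff_of_ne]
      rintro rfl
      exact hr (mul_left_cancel h).symm

theorem Cc.coeff_mul_of {s t u : G} (h : s * t = u) (x : B.Cc) (b : B.fiber t) :
    coeff B u (x * of B t b) = B.mul h (coeff B s x) b := by
  induction x using Cc.induction with
  | h0 => rw [zero_mul, map_zero, map_zero, zero_mul']
  | hadd x y hx hy => rw [_root_.add_mul, map_add, map_add, hx, hy, B.add_mul]
  | hof r x =>
    by_cases hr : r = s
    · subst hr; rw [of_mul_of h, coeff_of_same, coeff_of_same]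
    · rw [of_mul_of rfl, coeff_of_ne hr, zero_mul', coeff_of_ne]
      rintro rfl
      exact hr (mul_right_cancel h).symm

theorem incl_apply (t : G) (a : B.fiber t) : B.incl t a = coe (Cc.of B t a) := rfl

theorem fourier_incl_self (t : G) (a : B.fiber t) : B.fourier t (B.incl t a) = a := by
  rw [incl_apply, fourier_coe, Cc.coeff_of_same]

theorem incl_mul_incl {s t u : G} (h : s * t = u) (a : B.fiber s) (b : B.fiber t) :
    B.incl s a * B.incl t b = B.incl u (B.mul h a b) := by
  rw [incl_apply, incl_apply, ← coe_mul, Cc.of_mul_of h, incl_apply]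

/-- Left multiplication by `a ∈ B_t` has norm at most `‖a‖` on `ℓ²(B)`, so the embedding is
contractive. This is what makes `J ∩ B_t` closed for the norm of the fiber when `J` is closed in
`C*_r(B)`. -/
theorem continuous_incl (t : G) : Continuous (B.incl t) :=
  AddMonoidHomClass.continuous_of_bound (B.incl t) 1 fun a => by
    rw [incl_apply, norm_coe, one_mul]
    exact Cc.norm_regularRep_le _ (norm_nonneg a) (Cc.norm₂_of_mul_le a)

/-- Multiplication by a homogeneous element only shifts the grading. This is clear for finitely
supported sections, and both sides are continuous in `d`. -/
theorem fourier_incl_mul {s t u : G} (h : s * t = u) (a : B.fiber s) (d : B.Cr) :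
    B.fourier u (B.incl s a * d) = B.mul h a (B.fourier t d) := by
  have hc := continuous_mul_left h a
  refine CStarCompletion.induction_on d (isClosed_eq (by fun_prop)
    (hc.comp (B.fourier t).continuous)) fun x => ?_
  rw [incl_apply, ← coe_mul, fourier_coe, fourier_coe, Cc.coeff_of_mul h]

theorem fourier_mul_incl {s t u : G} (h : s * t = u) (d : B.Cr) (b : B.fiber t) :
    B.fourier u (d * B.incl t b) = B.mul h (B.fourier s d) b := by
  have hc := continuous_mul_right h b
  refine CStarCompletion.induction_on d (isClosed_eq (by fun_prop)
    (hc.comp (B.fourier s).continuous)) fun x => ?_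
  rw [incl_apply, ← coe_mul, fourier_coe, fourier_coe, Cc.coeff_mul_of h]

/-- By additivity only homogeneous `x = a ∈ B_s` matter, and there the coefficient at `u` is `a`
times the coefficient of `d` at `s⁻¹ u`. Together with the right-handed version, this makes all
matrix coefficients `F_1(x⋆ d y)` vanish. -/
theorem fourier_coe_mul_eq_zero {d : B.Cr} (hd : ∀ t, B.fourier t d = 0) (x : B.Cc) (u : G) :
    B.fourier u (coe x * d) = 0 := by
  induction x using Cc.induction with
  | h0 => rw [coe_zero, zero_mul, map_zero]
  | hadd x y hx hy => rw [coe_add, _root_.add_mul, map_add, hx, hy, add_zero]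
  | hof s a => rw [← incl_apply, fourier_incl_mul (mul_inv_cancel_left s u), hd, mul_zero']

theorem fourier_mul_coe_eq_zero {d : B.Cr} (hd : ∀ t, B.fourier t d = 0) (x : B.Cc) (u : G) :
    B.fourier u (d * coe x) = 0 := by
  induction x using Cc.induction with
  | h0 => rw [coe_zero, mul_zero, map_zero]
  | hadd x y hx hy => rw [coe_add, _root_.mul_add, map_add, hx, hy, add_zero]
  | hof s a => rw [← incl_apply, fourier_mul_incl (inv_mul_cancel_right u s), hd, zero_mul']

/-! ### Injectivity of the Fourier transform on the reduced algebra. -/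

/-- The matrix coefficients of an element of the reduced algebra are bounded by its norm. -/
theorem norm_fourier_star_mul_mul_le (d : B.Cr) (x y : B.Cc) :
    ‖B.fourier 1 (coe (star x) * d * coe y)‖ ≤ ‖d‖ * (Cc.norm₂ B x * Cc.norm₂ B y) := by
  refine CStarCompletion.induction_on d (isClosed_le (by fun_prop) (by fun_prop)) fun c => ?_
  rw [← coe_mul, ← coe_mul, fourier_coe, norm_coe, _root_.mul_assoc]
  -- For a section `c`, the coefficient at the unit is `⟨x, c y⟩`, so the Cauchy–Schwarz inequality
  -- applies.
  calc _ ≤ Cc.norm₂ B x * Cc.norm₂ B (c * y) := Cc.norm_ip_le x (c * y)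
    _ ≤ Cc.norm₂ B x * (‖c‖ * Cc.norm₂ B y) :=
      mul_le_mul_of_nonneg_left (Cc.norm₂_mul_le c y) (Cc.norm₂_nonneg x)
    _ = _ := by ring

/-- An element of the reduced algebra is determined by its Fourier coefficients. -/
theorem eq_zero_of_fourier_eq_zero {d : B.Cr} (hd : ∀ t, B.fourier t d = 0) : d = 0 := by
  -- The norm is an operator norm only on sections, so `d` is compared with sections `c`. Since `⟨c
  -- x, d x⟩ = 0`, one has `‖c x‖² = ‖⟨c x, (c - d) x⟩‖ ≤ ‖c - d‖ ‖c x‖ ‖x‖`; cancelling `‖c x‖`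
  -- bounds the operator norm of `c`.
  have key : ∀ c : B.Cc, ‖c‖ ≤ ‖(coe c : B.Cr) - d‖ := fun c => by
    refine Cc.norm_regularRep_le c (norm_nonneg _) fun x => ?_
    have h1 := norm_fourier_star_mul_mul_le (coe c - d) (c * x) x
    have h2 : B.fourier 1 (coe (star (c * x)) * d * coe x) = 0 :=
      fourier_mul_coe_eq_zero (fourier_coe_mul_eq_zero hd _) _ _
    rw [_root_.mul_sub, _root_.sub_mul, map_sub, h2, sub_zero, ← coe_mul, ← coe_mul, fourier_coe,
      _root_.mul_assoc] at h1
    change ‖Cc.ip (c * x) (c * x)‖ ≤ _ at h1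
    rw [← Cc.norm₂_sq] at h1
    rcases (Cc.norm₂_nonneg (c * x)).eq_or_lt with h0 | h0
    · rw [← h0]; exact mul_nonneg (norm_nonneg _) (Cc.norm₂_nonneg x)
    · refine le_of_mul_le_mul_right ?_ h0
      calc _ = Cc.norm₂ B (c * x) ^ 2 := by ring
        _ ≤ _ := h1
        _ = _ := by ring
  -- By density the bound extends to every `e` in the completion; the choice `e = d` gives `‖d‖ ≤
  -- 0`.
  have h : ∀ e : B.Cr, ‖e‖ ≤ ‖e - d‖ := fun e => CStarCompletion.induction_on e
    (isClosed_le (by fun_prop) (by fun_prop)) fun c => by rw [norm_coe]; exact key c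
  simpa using h d

/-! ### The maps `ι_r` and `κ_r`: isometry, surjectivity and kernel. -/

namespace Ideal

variable (J : B.Ideal)

theorem continuous_ιr : Continuous J.ιr := continuous_mapFun _

theorem continuous_κr : Continuous J.κr := continuous_mapFun _

theorem ιr_coe (a : J.toFellBundle.Cc) : J.ιr (coe a) = coe (J.ιc a) :=
  mapFun_coe _ J.norm_ιc_le a

theorem κr_coe (a : B.Cc) : J.κr (coe a) = coe (J.κc a) := mapFun_coe _ J.norm_κc_le a

theorem ιr_incl {t : G} (a : J.toFellBundle.fiber t) :
    J.ιr (J.toFellBundle.incl t a) = B.incl t (a : B.fiber t) := by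
  rw [incl_apply, ιr_coe, ιc_of, incl_apply]

theorem κr_incl {t : G} (a : B.fiber t) :
    J.κr (B.incl t a) = J.quotient.incl t (Submodule.Quotient.mk a) := by
  rw [incl_apply, κr_coe, κc_of, incl_apply]

/-- For the lower bound on `‖J.ιc a‖`, note that `ℓ²(J)` sits isometrically in `ℓ²(B)` and that the
action of `J.ιc a` restricts there to the action of `a`. Isometry gives both the injectivity of
`ι_r` and its closed range. -/
theorem norm_ιc (a : J.toFellBundle.Cc) : ‖J.ιc a‖ = ‖a‖ := by
  refine le_antisymm (J.norm_ιc_le a) (Cc.norm_regularRep_le a (norm_nonneg _) fun x => ?_)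
  rw [← norm₂_ιc, ← norm₂_ιc, map_mul]
  exact Cc.norm₂_mul_le _ _

theorem norm_ιr (a : J.toFellBundle.Cr) : ‖J.ιr a‖ = ‖a‖ :=
  CStarCompletion.induction_on a (isClosed_eq J.continuous_ιr.norm continuous_norm) fun a => by
    rw [ιr_coe, norm_coe, norm_coe, norm_ιc]

theorem isometry_ιr : Isometry J.ιr := AddMonoidHomClass.isometry_of_norm J.ιr J.norm_ιr

theorem isClosed_range_ιr : IsClosed (Set.range J.ιr) :=
  J.isometry_ιr.isClosedEmbedding.isClosed_range

/-- Every section of the quotient bundle lifts to a section of `B`, so the range is dense; a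
`*`-homomorphism with dense range is onto. -/
theorem κr_surjective : Function.Surjective J.κr := by
  refine J.κr.surjective_of_denseRange fun b => ?_
  refine CStarCompletion.induction_on b isClosed_closure fun y => subset_closure ?_
  obtain ⟨x, rfl⟩ := J.κc_surjective y
  exact ⟨coe x, J.κr_coe x⟩

/-- The inclusion of the range of `ι_r` in the kernel of `κ_r`, valid for every bundle: on sections,
all coefficients lie in the `J_t` and die in the quotient. -/
theorem κr_ιr (a : J.toFellBundle.Cr) : J.κr (J.ιr a) = 0 := by
  refine CStarCompletion.induction_on a
    (isClosed_eq (J.continuous_κr.comp J.continuous_ιr) continuous_const) fun a => ?_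
  have h : J.κc (J.ιc a) = 0 := Cc.ext fun t => by
    rw [coeff_κc, coeff_ιc, map_zero]
    exact (Submodule.Quotient.mk_eq_zero _).2 (Cc.coeff _ t a).2
  rw [ιr_coe, κr_coe, h, coe_zero]

theorem fourier_κr (t : G) (d : B.Cr) :
    J.quotient.fourier t (J.κr d) = Submodule.Quotient.mk (B.fourier t d) := by
  have hc : Continuous fun x : B.fiber t => (Submodule.Quotient.mk x : B.fiber t ⧸ J.carrier t) :=
    continuous_quot_mk
  refine CStarCompletion.induction_on d
    (isClosed_eq ((J.quotient.fourier t).continuous.comp J.continuous_κr)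
      (hc.comp (B.fourier t).continuous)) fun x => ?_
  rw [κr_coe, fourier_coe, fourier_coe, coeff_κc]

/-- The kernel of `κ_r` consists of the elements with Fourier coefficients in the ideal. -/
theorem κr_eq_zero_iff {d : B.Cr} : J.κr d = 0 ↔ ∀ t, B.fourier t d ∈ J.carrier t := by
  -- Injectivity of the Fourier transform is used here in `C*_r(B/J)`, not in `C*_r(B)`.
  refine ⟨fun h t => ?_, fun h => eq_zero_of_fourier_eq_zero fun t => ?_⟩
  · rw [← Submodule.Quotient.mk_eq_zero, ← fourier_κr, h, map_zero]
  · rw [fourier_κr, Submodule.Quotient.mk_eq_zero]; exact h t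

end Ideal

/-! ### Exactness implies that Fourier ideals are graded. -/

/-- The ideal of the bundle with fibers `J ∩ B_t`. -/
def IsIdeal.bundleIdeal {J : Submodule ℂ B.Cr} (hJ : IsIdeal J) : B.Ideal where
  carrier t := J.comap (B.incl t)
  isClosed t := hJ.isClosed.preimage (continuous_incl t)
  mul_mem_left h a b hb := by
    rw [Submodule.mem_comap, ← incl_mul_incl h]
    exact hJ.mul_mem_left _ _ hb
  mul_mem_right h a b ha := by
    rw [Submodule.mem_comap, ← incl_mul_incl h]
    exact hJ.mul_mem_right _ _ ha

/-- The range of `ι_r` for the ideal with fibers `J ∩ B_t` lies in the graded part of `J`. -/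
theorem IsIdeal.ιr_mem_graded {J : Submodule ℂ B.Cr} (hJ : IsIdeal J)
    (a : hJ.bundleIdeal.toFellBundle.Cr) :
    hJ.bundleIdeal.ιr a ∈ (⨆ t, J ⊓ LinearMap.range (B.incl t)).topologicalClosure := by
  refine CStarCompletion.induction_on a
    ((Submodule.isClosed_topologicalClosure _).preimage hJ.bundleIdeal.continuous_ιr) fun x => ?_
  refine Submodule.le_topologicalClosure _ ?_
  induction x using Cc.induction with
  | h0 => rw [coe_zero, map_zero]; exact zero_mem _
  | hadd x y hx hy => rw [coe_add, map_add]; exact add_mem hx hy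
  | hof t x =>
    rw [← incl_apply, Ideal.ιr_incl]
    exact Submodule.mem_iSup_of_mem t ⟨x.2, _, rfl⟩

/-- Being Fourier puts the coefficients of `d ∈ J` in `J ∩ B_t`, hence `d` in the kernel of `κ_r`
for that bundle ideal; exactness in the middle then writes `d` as a value of `ι_r`, a limit of sums
of elements of `J ∩ B_t`. The other inclusion needs only that `J` is closed. -/
theorem IsExact.isGraded (hB : B.IsExact) {J : Submodule ℂ B.Cr} (hJ : IsIdeal J)
    (hF : IsFourier J) : IsGraded J := by
  refine le_antisymm (fun d hd => ?_)
    (Submodule.topologicalClosure_minimal _ (iSup_le fun t => inf_le_left) hJ.isClosed)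
  obtain ⟨a, rfl⟩ := ((hB hJ.bundleIdeal).2.1 d).1
    (hJ.bundleIdeal.κr_eq_zero_iff.2 fun t => hF t d hd)
  exact hJ.ιr_mem_graded a

/-! ### Gradedness of the kernels of `κ_r` implies exactness. -/

namespace Ideal

variable (J : B.Ideal)

/-- The kernel of `κ_r`. -/
def kerκr : Submodule ℂ B.Cr := LinearMap.ker (J.κr : B.Cr →ₗ[ℂ] J.quotient.Cr)

theorem mem_kerκr {d : B.Cr} : d ∈ J.kerκr ↔ J.κr d = 0 := LinearMap.mem_ker

theorem isIdeal_kerκr : IsIdeal J.kerκr where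
  isClosed := isClosed_singleton.preimage J.continuous_κr
  mul_mem_left a b hb := by
    rw [mem_kerκr] at hb ⊢
    rw [map_mul, hb, mul_zero]
  mul_mem_right a b ha := by
    rw [mem_kerκr] at ha ⊢
    rw [map_mul, ha, zero_mul]

/-- Intersecting the kernel with the fibers gives back the original bundle ideal, so nothing is lost
in passing from `J` to the kernel of `κ_r`. -/
theorem incl_mem_kerκr {t : G} {a : B.fiber t} : B.incl t a ∈ J.kerκr ↔ a ∈ J.carrier t := by
  rw [mem_kerκr]
  refine ⟨fun h => ?_, fun h => ?_⟩
  · simpa only [fourier_incl_self] using J.κr_eq_zero_iff.1 h t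
  · rw [κr_incl, (Submodule.Quotient.mk_eq_zero _).2 h, map_zero]

theorem isFourier_kerκr : IsFourier J.kerκr := fun t _ hd =>
  J.incl_mem_kerκr.2 (J.κr_eq_zero_iff.1 (J.mem_kerκr.1 hd) t)

/-- A graded kernel is the closed span of its homogeneous elements. These lie in the `J_t`, hence in
the range of `ι_r`, which is closed because `ι_r` is isometric. -/
theorem kerκr_le_range_ιr (h : IsGraded J.kerκr) :
    J.kerκr ≤ LinearMap.range (J.ιr : J.toFellBundle.Cr →ₗ[ℂ] B.Cr) := by
  rw [h]
  refine Submodule.topologicalClosure_minimal _ (iSup_le fun t => ?_) J.isClosed_range_ιr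
  rintro _ ⟨hd, a, rfl⟩
  exact ⟨J.toFellBundle.incl t ⟨a, J.incl_mem_kerκr.1 hd⟩, J.ιr_incl _⟩

end Ideal

end FellBundle

end

/-- A Fell bundle `B` over a discrete group is exact if and only if every Fourier ideal in the
reduced cross-sectional algebra `C*_r(B)` is graded. -/
theorem mainTheorem5 {G : Type u} [Group G] (B : FellBundle.{u, v} G) :
    B.IsExact ↔ ∀ J : Submodule ℂ B.Cr,
      FellBundle.IsIdeal J → FellBundle.IsFourier J → FellBundle.IsGraded J := by
  -- In the converse, the hypothesis on Fourier ideals is needed only for the inclusion of the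
  -- kernel of `κ_r` in the range of `ι_r`, and only for the ideals `J.kerκr`.
  refine ⟨fun hB J hJ hF => hB.isGraded hJ hF, fun h J => ⟨J.isometry_ιr.injective,
    fun d => ⟨fun hd => ?_, ?_⟩, J.κr_surjective⟩⟩
  · exact J.kerκr_le_range_ιr (h _ J.isIdeal_kerκr J.isFourier_kerκr) (J.mem_kerκr.2 hd)
  · rintro ⟨a, rfl⟩
    exact J.κr_ιr a
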